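/- For $\alpha,\beta\in\mathbb{R}$ consider the boundary value problem $$-u''=\alpha u^{+}-\beta u^{-}\ \text{ in }(0,\pi),\qquad u(0)=u(\pi)=0,\tag{1}$$ where $u^{\pm}=\max(\pm u,0)$. For $n\ge 2$ let $\Gamma_n$ be the set of all $(\alpha,\beta)$ with $\alpha,\beta>0$ such that $\frac n2\frac{\pi}{\sqrt\alpha}+\frac n2\frac{\pi}{\sqrt\beta}=\pi$ if $n$ is even, and $\frac{n+1}2\frac{\pi}{\sqrt\alpha}+\frac{n-1}2\frac{\pi}{\sqrt\beta}=\pi$ if $n$ is odd. For $(\alpha,\beta)\in\Gamma_n$ let $f^n_{\alpha,\beta}$ be the solution $f\in C^2[0,\pi]$ of (1) with $f'(0)>0$ and $\sup_{[0,\pi]}|f|=1$; also put $f^1_{1,1}(x)=\sin x$. A Fučík system $F_{\alpha,\beta}$ is a sequence $\{f^n_{\alpha(n),\beta(n)}\}_{n\ge1}$, where $\alpha,\beta\colon\mathbb{N}\to\mathbb{R}$ satisfy $\alpha(1)=\beta(1)=1$ and $(\alpha(n),\beta(n))\in\Gamma_n$ for every $n\ge2$. A sequence $\{\psi_n\}$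 in $L^2(0,\pi)$ (with real or complex scalars) is a Riesz basis if its linear span is dense and there are constants $c,C>0$ such that $c\sum_{n=1}^N|a_n|^2\le\big\|\sum_{n=1}^N a_n\psi_n\big\|^2\le C\sum_{n=1}^N|a_n|^2$ for all $N\in\mathbb{N}$ and all scalars $a_1,\dots,a_N$. **Corollary.** Let $F_{\alpha,\beta}$ be a Fučík system and let $\varepsilon>0$ be fixed. Suppose that $$\max\left(\sqrt{\alpha(n)},\sqrt{\beta(n)}\right)\le n+\sqrt{c_n}\,n^{(1-\varepsilon)/2}\quad\text{for every } n\ge2,$$ with non-negative constants $c_n$ satisfying $$c_n<\frac{9}{8(3+\pi^2)}\cdot\frac{1}{\zeta(1+\varepsilon)-1}\quad\text{for even } n,$$ $$c_n<\frac{(n-1)^4}{8n^2(n^2+1)}\cdot\frac{1}{\zeta(1+\varepsilon)-1}\quad\text{for odd } n \text{ with } \alpha(n)\ge\beta(n),$$ $$c_n<\frac{(n+1)^4}{10n^2(n^2+1)}\cdot\frac{1}{\zeta(1+\varepsilon)-1}\quad\text{for odd } n \text{ with } \beta(n)>\alpha(n),$$ where $\zeta$ is the Riemann zeta function. Then $F_{\alpha,\beta}$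 is a Riesz basis of $L^2(0,\pi)$. -/

import Mathlib

open MeasureTheory

/-- `u` is a classical (that is, `C²` on `[0, π]`) solution of the boundary value problem
`-u'' = α u⁺ - β u⁻` in `(0, π)`, `u 0 = u π = 0`, where `u⁺ = max u 0` and `u⁻ = max (-u) 0`.
Only the values of `u` on `[0, π]` matter. -/
structure IsFucikSolution (α β : ℝ) (u : ℝ → ℝ) : Prop where
  contDiffOn : ContDiffOn ℝ 2 u (Set.Icc 0 Real.pi)
  equation : ∀ x ∈ Set.Ioo 0 Real.pi,
    -(deriv (deriv u) x) = α * max (u x) 0 - β * max (-(u x)) 0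
  left_boundary : u 0 = 0
  right_boundary : u Real.pi = 0

/-- The curve `Γ_n` of the Fučík spectrum, for `n ≥ 2`. The relation defining it involves
`π / √α` and `π / √β`, so both parameters are positive. -/
def fucikCurve (n : ℕ) : Set (ℝ × ℝ) :=
  {p | 0 < p.1 ∧ 0 < p.2 ∧
    ((Even n ∧ (n : ℝ) / 2 * (Real.pi / √p.1) + (n : ℝ) / 2 * (Real.pi / √p.2) = Real.pi) ∨
     (Odd n ∧ ((n : ℝ) + 1) / 2 * (Real.pi / √p.1) + ((n : ℝ) - 1) / 2 * (Real.pi / √p.2)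
        = Real.pi))}

/-- `f` is, on `[0, π]`, the normalized Fučík eigenfunction for the parameters `(α, β)`
(used for `(α, β)` on a curve `Γ_n` with `n ≥ 2`): a classical solution with positive slope
at `0` and supremum norm `1`. -/
structure IsNormalizedFucikEigenfunction (α β : ℝ) (f : ℝ → ℝ) : Prop where
  solution : IsFucikSolution α β f
  slope_pos : 0 < derivWithin f (Set.Icc 0 Real.pi) 0
  sup_norm : IsLUB ((fun x => |f x|) '' Set.Icc 0 Real.pi) 1

/-- `f 1, f 2, f 3, …` is the Fučík system with parameters `α, β`. The values of `α`, `β`, `f`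
at the index `0` play no role. -/
structure IsFucikSystem (α β : ℕ → ℝ) (f : ℕ → ℝ → ℝ) : Prop where
  alpha_one : α 1 = 1
  beta_one : β 1 = 1
  mem_curve : ∀ n : ℕ, 2 ≤ n → (α n, β n) ∈ fucikCurve n
  eq_sin : ∀ x ∈ Set.Icc 0 Real.pi, f 1 x = Real.sin x
  eigenfunction : ∀ n : ℕ, 2 ≤ n → IsNormalizedFucikEigenfunction (α n) (β n) (f n)

/-- The space `L²(0, π)` of `𝕜`-valued functions. -/
abbrev L2 (𝕜 : Type*) [RCLike 𝕜] : Type _ :=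
  Lp 𝕜 2 (volume.restrict (Set.Ioo 0 Real.pi))

/-- A family of vectors of a Hilbert space is a Riesz basis if it is complete (its linear span
is dense) and the squared norms of its finite linear combinations are comparable with the sums
of the squared moduli of the coefficients. -/
def IsRieszBasis (𝕜 : Type*) [RCLike 𝕜] {ι H : Type*} [NormedAddCommGroup H]
    [InnerProductSpace 𝕜 H] (ψ : ι → H) : Prop :=
  (Submodule.span 𝕜 (Set.range ψ)).topologicalClosure = ⊤ ∧
  ∃ c C : ℝ, 0 < c ∧ 0 < C ∧ ∀ (s : Finset ι) (a : ι → 𝕜),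
    c * ∑ i ∈ s, ‖a i‖ ^ 2 ≤ ‖∑ i ∈ s, a i • ψ i‖ ^ 2 ∧
    ‖∑ i ∈ s, a i • ψ i‖ ^ 2 ≤ C * ∑ i ∈ s, ‖a i‖ ^ 2

theorem IsFucikSystem.continuousOn {α β : ℕ → ℝ} {f : ℕ → ℝ → ℝ} (hF : IsFucikSystem α β f)
    (n : ℕ+) : ContinuousOn (f n) (Set.Icc 0 Real.pi) := by
  rcases Nat.lt_or_ge 1 (n : ℕ) with h | h
  · exact (hF.eigenfunction n h).solution.contDiffOn.continuousOn
  · have h1 : (n : ℕ) = 1 := le_antisymm h n.pos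
    rw [h1]
    exact Real.continuous_sin.continuousOn.congr hF.eq_sin

theorem IsFucikSystem.memLp (𝕜 : Type*) [RCLike 𝕜] {α β : ℕ → ℝ} {f : ℕ → ℝ → ℝ}
    (hF : IsFucikSystem α β f) (n : ℕ+) :
    MemLp (fun x => (f n x : 𝕜)) 2 (volume.restrict (Set.Ioo 0 Real.pi)) := by
  have hc : ContinuousOn (fun x => (f n x : 𝕜)) (Set.Icc 0 Real.pi) :=
    RCLike.continuous_ofReal.comp_continuousOn (hF.continuousOn n)
  obtain ⟨C, hC⟩ := isCompact_Icc.exists_bound_of_continuousOn hc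
  refine MemLp.of_bound
    ((hc.mono Set.Ioo_subset_Icc_self).aestronglyMeasurable measurableSet_Ioo) C ?_
  filter_upwards [ae_restrict_mem measurableSet_Ioo] with x hx
  exact hC x (Set.Ioo_subset_Icc_self hx)

/-- The `n`-th function of a Fučík system as an element of `L²(0, π)`. -/
noncomputable def IsFucikSystem.toL2 (𝕜 : Type*) [RCLike 𝕜] {α β : ℕ → ℝ} {f : ℕ → ℝ → ℝ}
    (hF : IsFucikSystem α β f) (n : ℕ+) : L2 𝕜 :=
  (hF.memLp 𝕜 n).toLp (fun x => (f n x : 𝕜))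

/-!
The functions `sin (n x)`, `n ≥ 1`, are an orthogonal basis of `L²(0, π)`, all of norm `√(π / 2)`.
A family `ψ n` with `∑ ‖ψ n - sin (n x)‖² < π / 2` is then a Riesz basis: Cauchy–Schwarz bounds the
perturbation of a finite linear combination, and a vector orthogonal to all `ψ n` has too small
sine coefficients to be nonzero (`isRieszBasis_of_tsum_sq_lt`). Since
`ζ (1 + ε) - 1 = ∑_{n ≥ 2} n ^ (-(1 + ε))`, it suffices that for every `n ≥ 2` the squared distance
of the `n`-th Fučík eigenfunction `f` to `sin (n x)` is less than
`(π / 2) n ^ (-(1 + ε)) / (ζ (1 + ε) - 1)`.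

By uniqueness for the initial value problem, `f` consists of half-waves of frequencies `√α`
(positive) and `√β` (negative) with a common slope `s` at the nodes; the normalization makes `s`
the smaller of the two frequencies. The overlap of one half-wave of frequency `p` with `sin (n x)`
is, explicitly, a cardinal sine of `(π / 2) (1 - n / p)` times the sine of `n` times the midpoint
(`integral_sin_bump_mul_sin`). The midpoints are within phase `(π / 2) |1 - n / √α|` of the
corresponding extrema of `sin (n x)`, so that every overlap is bounded below up to errors of second
order. In the sum over all half-waves the first order terms cancel, because the half-waves fill
`[0, π]` exactly (`bump_sum_le`). With `P` half-waves of the larger frequency `M` and `Q` of the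
smaller one, this gives
`‖f - sin (n x)‖² ≤ (M / n - 1)² π (P / Q) (n / (2 Q) + 3 / 4 + π² / 6)`,
and the three constants of the hypotheses are large enough for this bound.
-/

/-! ### Families quadratically near an orthogonal basis -/

/-- Paley–Wiener criterion: a family whose total squared distance to the orthogonal basis `r • e`
is less than `r ^ 2` is a Riesz basis. -/
theorem isRieszBasis_of_tsum_sq_lt {𝕜 ι H : Type*} [RCLike 𝕜] [NormedAddCommGroup H]
    [InnerProductSpace 𝕜 H] [CompleteSpace H] (e : HilbertBasis ι 𝕜 H) (ψ : ι → H) {r : ℝ}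
    (hr : 0 < r) (hs : Summable fun i => ‖ψ i - (r : 𝕜) • e i‖ ^ 2)
    (hlt : ∑' i, ‖ψ i - (r : 𝕜) • e i‖ ^ 2 < r ^ 2) : IsRieszBasis 𝕜 ψ := by
  set S := ∑' i, ‖ψ i - (r : 𝕜) • e i‖ ^ 2 with hS
  have hS0 : 0 ≤ S := tsum_nonneg fun i => by positivity
  have hq : √S < r := (Real.sqrt_lt' hr).2 hlt
  constructor
  · rw [Submodule.topologicalClosure_eq_top_iff, Submodule.eq_bot_iff]
    intro h hh
    have horth (i : ι) : inner 𝕜 h (ψ i) = 0 :=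
      Submodule.inner_left_of_mem_orthogonal
        (Submodule.subset_span (Set.mem_range_self i) : ψ i ∈ _) hh
    have hcoef (i : ι) : r ^ 2 * ‖inner 𝕜 h (e i)‖ ^ 2
        ≤ ‖h‖ ^ 2 * ‖ψ i - (r : 𝕜) • e i‖ ^ 2 := by
      have h1 := norm_inner_le_norm (𝕜 := 𝕜) h (ψ i - (r : 𝕜) • e i)
      rw [inner_sub_right, horth, zero_sub, norm_neg, inner_smul_right, norm_mul,
        RCLike.norm_ofReal, abs_of_pos hr] at h1
      rw [← mul_pow, ← mul_pow]
      exact pow_le_pow_left₀ (by positivity) h1 2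
    have hpars : HasSum (fun i => ‖inner 𝕜 h (e i)‖ ^ 2) (‖h‖ ^ 2) := by
      have h1 := RCLike.hasSum_re 𝕜 (e.hasSum_inner_mul_inner h h)
      rw [inner_self_eq_norm_sq] at h1
      refine h1.congr_fun ?_
      intro i
      rw [← inner_conj_symm (e i) h, RCLike.mul_conj]
      norm_cast
    have hle : r ^ 2 * ‖h‖ ^ 2 ≤ ‖h‖ ^ 2 * S :=
      hasSum_le hcoef (hpars.mul_left _) (hs.hasSum.mul_left _)
    by_contra hne
    have : 0 < ‖h‖ ^ 2 := by positivity
    nlinarith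
  · refine ⟨(r - √S) ^ 2, (r + √S) ^ 2, by nlinarith, by positivity, fun s a => ?_⟩
    set A := ∑ i ∈ s, ‖a i‖ ^ 2 with hA
    have hA0 : 0 ≤ A := Finset.sum_nonneg fun i _ => by positivity
    have hmain : ‖∑ i ∈ s, a i • ((r : 𝕜) • e i)‖ = r * √A := by
      have h1 : ∑ i ∈ s, a i • ((r : 𝕜) • e i) = (r : 𝕜) • ∑ i ∈ s, a i • e i := by
        rw [Finset.smul_sum]
        exact Finset.sum_congr rfl fun i _ => smul_comm _ _ _
      rw [h1, norm_smul, RCLike.norm_ofReal, abs_of_pos hr]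
      congr 1
      rw [← Real.sqrt_sq (norm_nonneg (∑ i ∈ s, a i • e i))]
      congr 1
      have h2 := e.orthonormal.inner_sum a a s
      rw [inner_self_eq_norm_sq_to_K] at h2
      simp_rw [RCLike.conj_mul] at h2
      exact_mod_cast h2
    have hpert : ‖∑ i ∈ s, a i • (ψ i - (r : 𝕜) • e i)‖ ≤ √A * √S := by
      calc ‖∑ i ∈ s, a i • (ψ i - (r : 𝕜) • e i)‖
          ≤ ∑ i ∈ s, ‖a i‖ * ‖ψ i - (r : 𝕜) • e i‖ :=
            (norm_sum_le _ _).trans (Finset.sum_le_sum fun i _ => (norm_smul _ _).le)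
        _ ≤ √A * √(∑ i ∈ s, ‖ψ i - (r : 𝕜) • e i‖ ^ 2) :=
            Real.sum_mul_le_sqrt_mul_sqrt _ _ _
        _ ≤ √A * √S := by
            gcongr
            exact hs.sum_le_tsum _ fun i _ => by positivity
    have hsplit : ∑ i ∈ s, a i • ψ i
        = ∑ i ∈ s, a i • ((r : 𝕜) • e i) + ∑ i ∈ s, a i • (ψ i - (r : 𝕜) • e i) := by
      rw [← Finset.sum_add_distrib]
      refine Finset.sum_congr rfl fun i _ => ?_
      rw [← smul_add, add_sub_cancel]
    have hup := norm_add_le (∑ i ∈ s, a i • ((r : 𝕜) • e i))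
      (∑ i ∈ s, a i • (ψ i - (r : 𝕜) • e i))
    have hlow := norm_sub_le_norm_add (∑ i ∈ s, a i • ((r : 𝕜) • e i))
      (∑ i ∈ s, a i • (ψ i - (r : 𝕜) • e i))
    rw [← hsplit, hmain] at hup hlow
    have hAsq : √A ^ 2 = A := Real.sq_sqrt hA0
    have hA' := Real.sqrt_nonneg A
    constructor
    · calc (r - √S) ^ 2 * A = ((r - √S) * √A) ^ 2 := by rw [mul_pow, hAsq]
        _ ≤ _ := pow_le_pow_left₀ (mul_nonneg (by linarith) hA') (by nlinarith) 2
    · calc _ ≤ ((r + √S) * √A) ^ 2 := pow_le_pow_left₀ (norm_nonneg _) (by nlinarith) 2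
        _ = (r + √S) ^ 2 * A := by rw [mul_pow, hAsq]

/-! ### Completeness of the sines in `L²(0, π)` -/

theorem integral_mul_sin_mul_cos_pow_eq_zero {w : ℝ → ℝ}
    (hw : IntegrableOn w (Set.Ioo 0 Real.pi))
    (h0 : ∀ n : ℕ, ∫ x in Set.Ioo 0 Real.pi, w x * Real.sin (n * x) = 0) (j : ℕ) :
    ∀ n : ℕ, ∫ x in Set.Ioo 0 Real.pi, w x * Real.sin (n * x) * Real.cos x ^ j = 0 := by
  have hint (j n : ℕ) : IntegrableOn (fun x => w x * Real.sin (n * x) * Real.cos x ^ j)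
      (Set.Ioo 0 Real.pi) := by
    have h1 : (fun x => w x * Real.sin (n * x) * Real.cos x ^ j)
        = fun x => (Real.sin (n * x) * Real.cos x ^ j) * w x := by
      ext x; ring
    rw [h1]
    refine Integrable.bdd_mul (c := 1) hw (by fun_prop) (ae_of_all _ fun x => ?_)
    rw [norm_mul, norm_pow, Real.norm_eq_abs, Real.norm_eq_abs]
    exact mul_le_one₀ (Real.abs_sin_le_one _) (by positivity)
      (pow_le_one₀ (abs_nonneg _) (Real.abs_cos_le_one _))
  induction j with
  | zero => simpa using h0
  | succ j ih =>
    intro n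
    rcases n with _ | n
    · simp
    · have h1 : ∀ x : ℝ, w x * Real.sin ((n + 1 : ℕ) * x) * Real.cos x ^ (j + 1)
          = (1 / 2) * (w x * Real.sin ((n + 2 : ℕ) * x) * Real.cos x ^ j
            + w x * Real.sin (n * x) * Real.cos x ^ j) := by
        intro x
        have e1 : ((n + 2 : ℕ) : ℝ) * x = (n + 1 : ℕ) * x + x := by push_cast; ring
        have e2 : (n : ℝ) * x = (n + 1 : ℕ) * x - x := by push_cast; ring
        rw [e1, e2, Real.sin_add, Real.sin_sub]
        ring
      simp_rw [h1]
      rw [integral_const_mul, integral_add (hint j (n + 2)) (hint j n), ih, ih]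
      simp

/-- An integrable function on `(0, π)` all of whose sine coefficients vanish is zero: it is
orthogonal to `sin x * p (cos x)` for every polynomial `p`, hence, by the Weierstrass theorem
after the substitution `t = cos x`, to `sin x * g x` for every continuous `g`. -/
theorem ae_eq_zero_of_integral_mul_sin_eq_zero {w : ℝ → ℝ}
    (hw : IntegrableOn w (Set.Ioo 0 Real.pi))
    (h0 : ∀ n : ℕ, ∫ x in Set.Ioo 0 Real.pi, w x * Real.sin (n * x) = 0) :
    ∀ᵐ x ∂(volume.restrict (Set.Ioo 0 Real.pi)), w x = 0 := by
  set μ := volume.restrict (Set.Ioo 0 Real.pi) with hμ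
  have hw1 : Integrable (fun x => w x * Real.sin x) μ := by
    refine hw.mul_bdd (c := 1) (by fun_prop) (ae_of_all _ fun x => ?_)
    simpa using Real.abs_sin_le_one x
  have hpolyint (p : Polynomial ℝ) :
      Integrable (fun x => w x * Real.sin x * p.eval (Real.cos x)) μ := by
    obtain ⟨C, hC⟩ := (isCompact_Icc (a := (-1 : ℝ)) (b := 1)).exists_bound_of_continuousOn
      p.continuous.continuousOn
    exact hw1.mul_bdd (c := C) (by fun_prop)
      (ae_of_all _ fun x => hC _ (Real.cos_mem_Icc x))
  have hpoly (p : Polynomial ℝ) : ∫ x, w x * Real.sin x * p.eval (Real.cos x) ∂μ = 0 := by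
    induction p using Polynomial.induction_on' with
    | add p q hp hq =>
      simp_rw [Polynomial.eval_add, mul_add]
      rw [integral_add (hpolyint p) (hpolyint q), hp, hq, add_zero]
    | monomial j a =>
      have h1 := integral_mul_sin_mul_cos_pow_eq_zero hw h0 j 1
      have h2 : ∀ x : ℝ, w x * Real.sin x * (Polynomial.monomial j a).eval (Real.cos x)
          = a * (w x * Real.sin ((1 : ℕ) * x) * Real.cos x ^ j) := by
        intro x
        rw [Polynomial.eval_monomial, Nat.cast_one, one_mul]
        ring
      simp_rw [h2]
      rw [integral_const_mul, h1, mul_zero]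
  have hcont (g : ℝ → ℝ) (hg : Continuous g) : ∫ x, g x • (w x * Real.sin x) ∂μ = 0 := by
    by_contra hne
    set I := ∫ x, |w x * Real.sin x| ∂μ with hI
    have hI0 : 0 ≤ I := integral_nonneg fun x => abs_nonneg _
    have hpos := abs_pos.2 hne
    set J := ∫ x, g x • (w x * Real.sin x) ∂μ with hJ
    obtain ⟨p, hp⟩ := exists_polynomial_near_of_continuousOn (-1) 1 (fun t => g (Real.arccos t))
      (hg.comp Real.continuous_arccos).continuousOn (|J| / (2 * (I + 1))) (by positivity)
    have hgint : Integrable (fun x => g x • (w x * Real.sin x)) μ := by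
      obtain ⟨C, hC⟩ := (isCompact_Icc (a := (0 : ℝ)) (b := Real.pi)).exists_bound_of_continuousOn
        hg.continuousOn
      refine hw1.bdd_mul (c := C) (by fun_prop) ?_
      filter_upwards [ae_restrict_mem measurableSet_Ioo] with x hx
      exact hC x (Set.Ioo_subset_Icc_self hx)
    have hdiff : J = ∫ x, (g x • (w x * Real.sin x)
        - w x * Real.sin x * p.eval (Real.cos x)) ∂μ := by
      rw [integral_sub hgint (hpolyint p), hpoly, sub_zero]
    have hbound : |J| ≤ |J| / (2 * (I + 1)) * I := by
      calc |J| = ‖J‖ := rfl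
        _ ≤ ∫ x, |J| / (2 * (I + 1)) * |w x * Real.sin x| ∂μ := by
          rw [hdiff]
          refine norm_integral_le_of_norm_le (hw1.abs.const_mul _) ?_
          filter_upwards [ae_restrict_mem measurableSet_Ioo] with x hx
          have h1 := hp (Real.cos x) (Real.cos_mem_Icc x)
          rw [Real.arccos_cos hx.1.le hx.2.le, abs_sub_comm] at h1
          have h2 : g x • (w x * Real.sin x) - w x * Real.sin x * p.eval (Real.cos x)
              = (g x - p.eval (Real.cos x)) * (w x * Real.sin x) := by
            rw [smul_eq_mul]; ring
          rw [h2, Real.norm_eq_abs, abs_mul]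
          rw [← hdiff]
          exact mul_le_mul_of_nonneg_right h1.le (abs_nonneg _)
        _ = |J| / (2 * (I + 1)) * I := by rw [integral_const_mul]
    have : |J| / (2 * (I + 1)) * I = |J| * (I / (2 * (I + 1))) := by ring
    have h3 : I / (2 * (I + 1)) < 1 := by
      rw [div_lt_one (by positivity)]; linarith
    nlinarith
  have hzero := isOpen_Ioo.ae_eq_zero_of_integral_contDiff_smul_eq_zero (μ := volume)
    (f := fun x => w x * Real.sin x) (U := Set.Ioo 0 Real.pi)
    (IntegrableOn.locallyIntegrableOn hw1) (fun g hg _ hsupp => by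
      rw [← hcont g hg.continuous, hμ]
      refine (setIntegral_eq_integral_of_forall_compl_eq_zero fun x hx => ?_).symm
      rw [image_eq_zero_of_notMem_tsupport fun h => hx (hsupp h), zero_smul])
  rw [hμ, ae_restrict_iff' measurableSet_Ioo]
  filter_upwards [hzero] with x hx hmem
  exact (mul_eq_zero.1 (hx hmem)).resolve_right (Real.sin_pos_of_mem_Ioo hmem).ne'

theorem integral_cos_intCast_mul {k : ℤ} (hk : k ≠ 0) :
    ∫ x in (0 : ℝ)..Real.pi, Real.cos (k * x) = 0 := by
  have hk' : (k : ℝ) ≠ 0 := by exact_mod_cast hk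
  rw [intervalIntegral.integral_comp_mul_left (fun x => Real.cos x) hk', integral_cos]
  simp [Real.sin_int_mul_pi]

theorem integral_sin_natCast_mul_sin_natCast (m n : ℕ+) :
    ∫ x in (0 : ℝ)..Real.pi, Real.sin (m * x) * Real.sin (n * x)
      = if m = n then Real.pi / 2 else 0 := by
  have h1 : ∀ x : ℝ, Real.sin (m * x) * Real.sin (n * x)
      = (1 / 2) * (Real.cos (((m : ℤ) - (n : ℤ) : ℤ) * x)
        - Real.cos (((m : ℤ) + (n : ℤ) : ℤ) * x)) := by
    intro x
    push_cast
    rw [sub_mul, add_mul, Real.cos_sub, Real.cos_add]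
    ring
  have hsum : ((m : ℤ) + (n : ℤ) : ℤ) ≠ 0 := by positivity
  simp_rw [h1]
  rw [intervalIntegral.integral_const_mul, intervalIntegral.integral_sub
    (Continuous.intervalIntegrable (by fun_prop) _ _)
    (Continuous.intervalIntegrable (by fun_prop) _ _), integral_cos_intCast_mul hsum, sub_zero]
  split_ifs with h
  · subst h
    simp
    ring
  · have hne : ((m : ℤ) - (n : ℤ) : ℤ) ≠ 0 := by
      intro h'
      exact h (PNat.eq (by omega))
    rw [integral_cos_intCast_mul hne, mul_zero]

theorem memLp_ofReal_sin (𝕜 : Type*) [RCLike 𝕜] (n : ℕ+) :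
    MemLp (fun x : ℝ => ((Real.sin (n * x) : ℝ) : 𝕜)) 2
      (volume.restrict (Set.Ioo 0 Real.pi)) := by
  refine MemLp.of_bound (Continuous.aestronglyMeasurable (by fun_prop)) 1
    (ae_of_all _ fun x => ?_)
  rw [RCLike.norm_ofReal]
  exact Real.abs_sin_le_one _

/-- The orthogonal family `sin (n x)`, `n ≥ 1`, in `L²(0, π)`. -/
noncomputable def sineL2 (𝕜 : Type*) [RCLike 𝕜] (n : ℕ+) : L2 𝕜 :=
  (memLp_ofReal_sin 𝕜 n).toLp

theorem inner_sineL2 {𝕜 : Type*} [RCLike 𝕜] (n : ℕ+) (h : L2 𝕜) :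
    inner 𝕜 (sineL2 𝕜 n) h
      = ∫ x in Set.Ioo 0 Real.pi, h x * ((Real.sin (n * x) : ℝ) : 𝕜) := by
  rw [L2.inner_def]
  refine integral_congr_ae ?_
  filter_upwards [(memLp_ofReal_sin 𝕜 n).coeFn_toLp] with x hx
  rw [sineL2, hx, RCLike.inner_apply, RCLike.conj_ofReal]

theorem inner_sineL2_sineL2 {𝕜 : Type*} [RCLike 𝕜] (m n : ℕ+) :
    inner 𝕜 (sineL2 𝕜 m) (sineL2 𝕜 n) = if m = n then ((Real.pi / 2 : ℝ) : 𝕜) else 0 := by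
  rw [inner_sineL2]
  have h1 : ∫ x in Set.Ioo 0 Real.pi, sineL2 𝕜 n x * ((Real.sin (m * x) : ℝ) : 𝕜)
      = ∫ x in Set.Ioo 0 Real.pi, ((Real.sin (m * x) * Real.sin (n * x) : ℝ) : 𝕜) := by
    refine integral_congr_ae ?_
    filter_upwards [(memLp_ofReal_sin 𝕜 n).coeFn_toLp] with x hx
    rw [sineL2, hx, mul_comm, RCLike.ofReal_mul]
  rw [h1, integral_ofReal, ← integral_Ioc_eq_integral_Ioo,
    ← intervalIntegral.integral_of_le Real.pi_pos.le, integral_sin_natCast_mul_sin_natCast]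
  split_ifs <;> simp

theorem eq_zero_of_inner_sineL2_eq_zero {𝕜 : Type*} [RCLike 𝕜] {h : L2 𝕜}
    (h0 : ∀ n, inner 𝕜 (sineL2 𝕜 n) h = 0) : h = 0 := by
  set μ := volume.restrict (Set.Ioo 0 Real.pi) with hμ
  have hint : Integrable h μ := (Lp.memLp h).integrable one_le_two
  have hprod (n : ℕ) : Integrable (fun x => h x * ((Real.sin (n * x) : ℝ) : 𝕜)) μ := by
    refine hint.mul_bdd (c := 1) (Continuous.aestronglyMeasurable (by fun_prop))
      (ae_of_all _ fun x => ?_)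
    rw [RCLike.norm_ofReal]
    exact Real.abs_sin_le_one _
  have hzero (n : ℕ) : ∫ x, h x * ((Real.sin (n * x) : ℝ) : 𝕜) ∂μ = 0 := by
    rcases n.eq_zero_or_pos with rfl | hn
    · simp
    · exact (inner_sineL2 ⟨n, hn⟩ h).symm.trans (h0 ⟨n, hn⟩)
  have hre : ∀ᵐ x ∂μ, RCLike.re (h x) = 0 := by
    refine ae_eq_zero_of_integral_mul_sin_eq_zero hint.re fun n => ?_
    have h1 := integral_re (hprod n)
    rw [hzero, map_zero] at h1
    simpa only [RCLike.re_mul_ofReal] using h1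
  have him : ∀ᵐ x ∂μ, RCLike.im (h x) = 0 := by
    refine ae_eq_zero_of_integral_mul_sin_eq_zero hint.im fun n => ?_
    have h1 := integral_im (hprod n)
    rw [hzero, map_zero] at h1
    simpa only [RCLike.im_mul_ofReal] using h1
  rw [Lp.eq_zero_iff_ae_eq_zero]
  filter_upwards [hre, him] with x h1 h2
  exact RCLike.ext (by simpa using h1) (by simpa using h2)

/-- The functions `√(2 / π) sin (n x)`, `n ≥ 1`, form a Hilbert basis of `L²(0, π)`. -/
theorem exists_hilbertBasis_sine (𝕜 : Type*) [RCLike 𝕜] :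
    ∃ e : HilbertBasis ℕ+ 𝕜 (L2 𝕜), ∀ n, ((√(Real.pi / 2) : ℝ) : 𝕜) • e n = sineL2 𝕜 n := by
  have hr : 0 < √(Real.pi / 2) := Real.sqrt_pos.2 (by positivity)
  have hr' : ((√(Real.pi / 2) : ℝ) : 𝕜) ≠ 0 := by exact_mod_cast hr.ne'
  set v : ℕ+ → L2 𝕜 := fun n => ((√(Real.pi / 2) : ℝ) : 𝕜)⁻¹ • sineL2 𝕜 n with hv
  have hon : Orthonormal 𝕜 v := by
    rw [orthonormal_iff_ite]
    intro m n
    rw [hv, inner_smul_left, inner_smul_right, inner_sineL2_sineL2, map_inv₀, RCLike.conj_ofReal]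
    split_ifs
    · have h1 : (√(Real.pi / 2))⁻¹ * ((√(Real.pi / 2))⁻¹ * (Real.pi / 2)) = 1 := by
        rw [← mul_assoc, ← mul_inv, Real.mul_self_sqrt (by positivity)]
        exact inv_mul_cancel₀ (by positivity)
      exact_mod_cast congrArg (RCLike.ofReal (K := 𝕜)) h1
    · simp
  have hbot : (Submodule.span 𝕜 (Set.range v))ᗮ = ⊥ := by
    rw [Submodule.eq_bot_iff]
    intro h hh
    refine eq_zero_of_inner_sineL2_eq_zero fun n => ?_
    have h1 := Submodule.inner_right_of_mem_orthogonal
      (Submodule.subset_span (Set.mem_range_self n) : v n ∈ _) hh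
    rw [hv, inner_smul_left] at h1
    exact (mul_eq_zero.1 h1).resolve_left (by simpa using hr.ne')
  refine ⟨HilbertBasis.mkOfOrthogonalEqBot hon hbot, fun n => ?_⟩
  rw [HilbertBasis.coe_mkOfOrthogonalEqBot, hv, smul_inv_smul₀ hr']

/-! ### The shape of the Fučík eigenfunctions -/

/-- `(u, v)` solves on `[a, b]` the first order system `u' = v`, `v' = -(α u⁺ - β u⁻)`, with
one-sided derivatives. -/
structure IsFucikTrajectory (α β a b : ℝ) (u v : ℝ → ℝ) : Prop where
  continuousOn_fst : ContinuousOn u (Set.Icc a b)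
  continuousOn_snd : ContinuousOn v (Set.Icc a b)
  hasDeriv_fst : ∀ t ∈ Set.Ico a b, HasDerivWithinAt u (v t) (Set.Ici t) t
  hasDeriv_snd : ∀ t ∈ Set.Ico a b,
    HasDerivWithinAt v (-(α * max (u t) 0 - β * max (-(u t)) 0)) (Set.Ici t) t

theorem lipschitzWith_fucikField (α β : ℝ) :
    LipschitzWith (Real.toNNReal (1 + |α| + |β|))
      (fun p : ℝ × ℝ => (p.2, -(α * max p.1 0 - β * max (-p.1) 0))) := by
  refine LipschitzWith.of_dist_le' fun p q => ?_
  have h1 : |p.1 - q.1| ≤ dist p q := by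
    rw [Prod.dist_eq, ← Real.dist_eq]; exact le_max_left _ _
  have h2 : |p.2 - q.2| ≤ dist p q := by
    rw [Prod.dist_eq, ← Real.dist_eq]; exact le_max_right _ _
  have h3 : |max p.1 0 - max q.1 0| ≤ |p.1 - q.1| := abs_max_sub_max_le_abs _ _ _
  have h4 : |max (-p.1) 0 - max (-q.1) 0| ≤ |p.1 - q.1| := by
    refine (abs_max_sub_max_le_abs _ _ _).trans_eq ?_
    rw [neg_sub_neg, abs_sub_comm]
  have hd : 0 ≤ dist p q := dist_nonneg
  have hα := abs_nonneg α
  have hβ := abs_nonneg β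
  rw [Prod.dist_eq]
  refine max_le ?_ ?_
  · change |p.2 - q.2| ≤ _
    nlinarith
  · rw [Real.dist_eq]
    have e : -(α * max p.1 0 - β * max (-p.1) 0) - -(α * max q.1 0 - β * max (-q.1) 0)
        = -(α * (max p.1 0 - max q.1 0)) + β * (max (-p.1) 0 - max (-q.1) 0) := by ring
    rw [e]
    refine (abs_add_le _ _).trans ?_
    rw [abs_neg, abs_mul, abs_mul]
    have h5 := mul_le_mul_of_nonneg_left (h3.trans h1) hα
    have h6 := mul_le_mul_of_nonneg_left (h4.trans h1) hβ
    linarith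

namespace IsFucikTrajectory

variable {α β a b : ℝ} {u v w z : ℝ → ℝ}

theorem mono (h : IsFucikTrajectory α β a b u v) {a' b' : ℝ} (ha : a ≤ a') (hb : b' ≤ b) :
    IsFucikTrajectory α β a' b' u v where
  continuousOn_fst := h.continuousOn_fst.mono (Set.Icc_subset_Icc ha hb)
  continuousOn_snd := h.continuousOn_snd.mono (Set.Icc_subset_Icc ha hb)
  hasDeriv_fst t ht := h.hasDeriv_fst t ⟨ha.trans ht.1, ht.2.trans_le hb⟩
  hasDeriv_snd t ht := h.hasDeriv_snd t ⟨ha.trans ht.1, ht.2.trans_le hb⟩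

theorem neg (h : IsFucikTrajectory α β a b u v) :
    IsFucikTrajectory β α a b (fun t => -u t) (fun t => -v t) where
  continuousOn_fst := h.continuousOn_fst.neg
  continuousOn_snd := h.continuousOn_snd.neg
  hasDeriv_fst t ht := (h.hasDeriv_fst t ht).neg
  hasDeriv_snd t ht := by
    refine (h.hasDeriv_snd t ht).neg.congr_deriv ?_
    simp only [neg_neg]
    ring

theorem eqOn (h : IsFucikTrajectory α β a b u v) (h' : IsFucikTrajectory α β a b w z)
    (hu : u a = w a) (hv : v a = z a) :
    ∀ t ∈ Set.Icc a b, u t = w t ∧ v t = z t := by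
  have h1 : Set.EqOn (fun t => (u t, v t)) (fun t => (w t, z t)) (Set.Icc a b) :=
    ODE_solution_unique (v := fun _ p => (p.2, -(α * max p.1 0 - β * max (-p.1) 0)))
      (fun _ => lipschitzWith_fucikField α β)
      (h.continuousOn_fst.prodMk h.continuousOn_snd)
      (fun t ht => (h.hasDeriv_fst t ht).prodMk (h.hasDeriv_snd t ht))
      (h'.continuousOn_fst.prodMk h'.continuousOn_snd)
      (fun t ht => (h'.hasDeriv_fst t ht).prodMk (h'.hasDeriv_snd t ht))
      (by simp [hu, hv])
  exact fun t ht => Prod.mk_inj.1 (h1 ht)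

end IsFucikTrajectory

/-- A half-wave of frequency `p` is a trajectory on its first bump, where it is nonnegative. -/
theorem isFucikTrajectory_sin {p : ℝ} (β x₀ : ℝ) {s : ℝ} (hp : 0 < p) (hs : 0 ≤ s) :
    IsFucikTrajectory (p ^ 2) β x₀ (x₀ + Real.pi / p)
      (fun t => s / p * Real.sin (p * (t - x₀))) (fun t => s * Real.cos (p * (t - x₀))) where
  continuousOn_fst := by fun_prop
  continuousOn_snd := by fun_prop
  hasDeriv_fst t _ := by
    have h1 : HasDerivAt (fun t : ℝ => p * (t - x₀)) (p * 1) t :=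
      ((hasDerivAt_id t).sub_const x₀).const_mul p
    refine ((h1.sin).const_mul (s / p)).hasDerivWithinAt.congr_deriv ?_
    field_simp
  hasDeriv_snd t ht := by
    have h1 : HasDerivAt (fun t : ℝ => p * (t - x₀)) (p * 1) t :=
      ((hasDerivAt_id t).sub_const x₀).const_mul p
    have hnn : 0 ≤ s / p * Real.sin (p * (t - x₀)) := by
      refine mul_nonneg (by positivity) (Real.sin_nonneg_of_nonneg_of_le_pi ?_ ?_)
      · exact mul_nonneg hp.le (by linarith [ht.1])
      · have h2 := mul_le_mul_of_nonneg_left (sub_le_iff_le_add'.2 ht.2.le) hp.le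
        rwa [mul_div_cancel₀ _ hp.ne'] at h2
    refine ((h1.cos).const_mul s).hasDerivWithinAt.congr_deriv ?_
    rw [max_eq_left hnn, max_eq_right (neg_nonpos.2 hnn)]
    field_simp
    ring

theorem IsFucikSolution.isFucikTrajectory {α β : ℝ} {u : ℝ → ℝ} (h : IsFucikSolution α β u) :
    IsFucikTrajectory α β 0 Real.pi u (derivWithin u (Set.Icc 0 Real.pi)) := by
  set I := Set.Icc (0 : ℝ) Real.pi with hI
  have hI' : UniqueDiffOn ℝ I := uniqueDiffOn_Icc Real.pi_pos
  have hv : ContDiffOn ℝ 1 (derivWithin u I) I := h.contDiffOn.derivWithin hI' (by norm_num)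
  have hw : ContinuousOn (derivWithin (derivWithin u I) I) I :=
    (hv.derivWithin hI' (m := 0) (by norm_num)).continuousOn
  have hnhds {t : ℝ} (ht : t ∈ Set.Ico 0 Real.pi) : I ∈ nhdsWithin t (Set.Ici t) :=
    Filter.mem_of_superset (Icc_mem_nhdsGE ht.2) (Set.Icc_subset_Icc_left ht.1)
  have hint : ∀ t ∈ Set.Ioo 0 Real.pi, derivWithin (derivWithin u I) I t
      = -(α * max (u t) 0 - β * max (-(u t)) 0) := by
    intro t ht
    have hev : derivWithin u I =ᶠ[nhds t] deriv u := by
      filter_upwards [isOpen_Ioo.mem_nhds ht] with y hy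
      exact derivWithin_of_mem_nhds (Icc_mem_nhds hy.1 hy.2)
    rw [derivWithin_of_mem_nhds (Icc_mem_nhds ht.1 ht.2), hev.deriv_eq, ← h.equation t ht, neg_neg]
  have hcl : ∀ t ∈ I, derivWithin (derivWithin u I) I t
      = -(α * max (u t) 0 - β * max (-(u t)) 0) := by
    have hu := h.contDiffOn.continuousOn
    have h1 : Set.EqOn (derivWithin (derivWithin u I) I)
        (fun t => -(α * max (u t) 0 - β * max (-(u t)) 0)) I := by
      refine Set.EqOn.of_subset_closure (s := Set.Ioo 0 Real.pi) (fun t ht => hint t ht) hw ?_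
        Set.Ioo_subset_Icc_self ?_
      · exact (((continuousOn_const.mul (hu.sup continuousOn_const)).sub
          (continuousOn_const.mul (hu.neg.sup continuousOn_const))).neg)
      · rw [closure_Ioo Real.pi_pos.ne]
    exact fun t ht => h1 ht
  refine ⟨h.contDiffOn.continuousOn, hv.continuousOn, fun t ht => ?_, fun t ht => ?_⟩
  · exact ((h.contDiffOn.differentiableOn (by norm_num) t
      ⟨ht.1, ht.2.le⟩).hasDerivWithinAt).mono_of_mem_nhdsWithin (hnhds ht)
  · rw [← hcl t ⟨ht.1, ht.2.le⟩]
    exact ((hv.differentiableOn (by norm_num) t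
      ⟨ht.1, ht.2.le⟩).hasDerivWithinAt).mono_of_mem_nhdsWithin (hnhds ht)

namespace IsFucikTrajectory

variable {p q b s : ℝ} {u v : ℝ → ℝ}

theorem eq_sin {β x₀ : ℝ} (hp : 0 < p) (hs : 0 ≤ s)
    (h : IsFucikTrajectory (p ^ 2) β x₀ (x₀ + Real.pi / p) u v) (hu : u x₀ = 0) (hv : v x₀ = s) :
    ∀ t ∈ Set.Icc x₀ (x₀ + Real.pi / p),
      u t = s / p * Real.sin (p * (t - x₀)) ∧ v t = s * Real.cos (p * (t - x₀)) :=
  h.eqOn (isFucikTrajectory_sin β x₀ hp hs) (by simp [hu]) (by simp [hv])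

theorem eq_neg_sin {α x₀ : ℝ} (hq : 0 < q) (hs : 0 ≤ s)
    (h : IsFucikTrajectory α (q ^ 2) x₀ (x₀ + Real.pi / q) u v) (hu : u x₀ = 0)
    (hv : v x₀ = -s) :
    ∀ t ∈ Set.Icc x₀ (x₀ + Real.pi / q),
      u t = -(s / q * Real.sin (q * (t - x₀))) ∧ v t = -(s * Real.cos (q * (t - x₀))) := by
  intro t ht
  have h1 := h.neg.eq_sin hq hs (by simp [hu]) (by simp [hv]) t ht
  exact ⟨by linarith [h1.1], by linarith [h1.2]⟩

theorem end_of_positive_bump {β x₀ : ℝ} (hp : 0 < p) (hs : 0 ≤ s)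
    (h : IsFucikTrajectory (p ^ 2) β x₀ (x₀ + Real.pi / p) u v) (hu : u x₀ = 0) (hv : v x₀ = s) :
    u (x₀ + Real.pi / p) = 0 ∧ v (x₀ + Real.pi / p) = -s := by
  have h1 := h.eq_sin hp hs hu hv (x₀ + Real.pi / p) ⟨by simp; positivity, le_rfl⟩
  rw [add_sub_cancel_left, mul_div_cancel₀ _ hp.ne'] at h1
  simpa using h1

theorem end_of_negative_bump {α x₀ : ℝ} (hq : 0 < q) (hs : 0 ≤ s)
    (h : IsFucikTrajectory α (q ^ 2) x₀ (x₀ + Real.pi / q) u v) (hu : u x₀ = 0)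
    (hv : v x₀ = -s) :
    u (x₀ + Real.pi / q) = 0 ∧ v (x₀ + Real.pi / q) = s := by
  have h1 := h.eq_neg_sin hq hs hu hv (x₀ + Real.pi / q) ⟨by simp; positivity, le_rfl⟩
  rw [add_sub_cancel_left, mul_div_cancel₀ _ hq.ne'] at h1
  simpa using h1

theorem start_of_period (hp : 0 < p) (hq : 0 < q) (hs : 0 ≤ s)
    (h : IsFucikTrajectory (p ^ 2) (q ^ 2) 0 b u v) (hu : u 0 = 0) (hv : v 0 = s) (k : ℕ)
    (hk : k * (Real.pi / p + Real.pi / q) ≤ b) :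
    u (k * (Real.pi / p + Real.pi / q)) = 0 ∧ v (k * (Real.pi / p + Real.pi / q)) = s := by
  have hl₁ : 0 < Real.pi / p := by positivity
  have hl₂ : 0 < Real.pi / q := by positivity
  induction k with
  | zero => simpa using ⟨hu, hv⟩
  | succ k ih =>
    push_cast at hk ⊢
    have hx : 0 ≤ k * (Real.pi / p + Real.pi / q) := by positivity
    obtain ⟨h1, h2⟩ := ih (by linarith)
    obtain ⟨h3, h4⟩ := (h.mono hx (by linarith)).end_of_positive_bump hp hs h1 h2
    obtain ⟨h5, h6⟩ := (h.mono (a' := k * (Real.pi / p + Real.pi / q) + Real.pi / p)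
      (by linarith) (by linarith)).end_of_negative_bump hq hs h3 h4
    rw [add_mul, one_mul, ← add_assoc]
    exact ⟨h5, h6⟩

/-- The `k`-th positive bump of a trajectory starting at `0` with slope `s`. -/
theorem eq_on_positive_bump (hp : 0 < p) (hq : 0 < q) (hs : 0 ≤ s)
    (h : IsFucikTrajectory (p ^ 2) (q ^ 2) 0 b u v) (hu : u 0 = 0) (hv : v 0 = s) (k : ℕ)
    {x₀ : ℝ} (hx₀ : x₀ = k * (Real.pi / p + Real.pi / q)) (hk : x₀ + Real.pi / p ≤ b) :
    ∀ t ∈ Set.Icc x₀ (x₀ + Real.pi / p), u t = s / p * Real.sin (p * (t - x₀)) := by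
  have hl₁ : 0 < Real.pi / p := by positivity
  obtain ⟨h1, h2⟩ := h.start_of_period hp hq hs hu hv k (by linarith)
  rw [← hx₀] at h1 h2
  exact fun t ht => ((h.mono (by rw [hx₀]; positivity) hk).eq_sin hp hs h1 h2 t ht).1

/-- The `k`-th negative bump of a trajectory starting at `0` with slope `s`. -/
theorem eq_on_negative_bump (hp : 0 < p) (hq : 0 < q) (hs : 0 ≤ s)
    (h : IsFucikTrajectory (p ^ 2) (q ^ 2) 0 b u v) (hu : u 0 = 0) (hv : v 0 = s) (k : ℕ)
    {x₀ : ℝ} (hx₀ : x₀ = k * (Real.pi / p + Real.pi / q) + Real.pi / p)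
    (hk : x₀ + Real.pi / q ≤ b) :
    ∀ t ∈ Set.Icc x₀ (x₀ + Real.pi / q), u t = -(s / q * Real.sin (q * (t - x₀))) := by
  have hl₁ : 0 < Real.pi / p := by positivity
  have hl₂ : 0 < Real.pi / q := by positivity
  obtain ⟨h1, h2⟩ := h.start_of_period hp hq hs hu hv k (by linarith)
  have hx : 0 ≤ k * (Real.pi / p + Real.pi / q) := by positivity
  obtain ⟨h3, h4⟩ := (h.mono hx (by linarith)).end_of_positive_bump hp hs h1 h2
  rw [← hx₀] at h3 h4
  exact fun t ht => ((h.mono (by linarith) hk).eq_neg_sin hq hs h3 h4 t ht).1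

end IsFucikTrajectory

/-- An induction over consecutive bumps: a property of all the points of `N` full periods,
possibly followed by one more positive bump, is checked on each bump. -/
theorem forall_mem_Icc_of_bumps {l₁ l₂ : ℝ} {P N : ℕ} (hPN : P = N ∨ P = N + 1)
    {C : ℝ → Prop}
    (h₁ : ∀ k < P, ∀ t ∈ Set.Icc (k * (l₁ + l₂)) (k * (l₁ + l₂) + l₁), C t)
    (h₂ : ∀ k < N, ∀ t ∈ Set.Icc (k * (l₁ + l₂) + l₁) (k * (l₁ + l₂) + l₁ + l₂), C t)
    (h0 : C 0) : ∀ t ∈ Set.Icc 0 (P * l₁ + N * l₂), C t := by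
  have hper : ∀ k ≤ N, ∀ t ∈ Set.Icc 0 (k * (l₁ + l₂)), C t := by
    intro k
    induction k with
    | zero =>
      intro _ t ht
      obtain rfl : t = 0 := le_antisymm (by simpa using ht.2) ht.1
      exact h0
    | succ k ih =>
      intro hk t ht
      push_cast at ht
      rcases le_total t (k * (l₁ + l₂)) with h | h
      · exact ih (by omega) t ⟨ht.1, h⟩
      · rcases le_total t (k * (l₁ + l₂) + l₁) with h' | h'
        · exact h₁ k (by omega) t ⟨h, h'⟩
        · exact h₂ k (by omega) t ⟨h', by linarith [ht.2]⟩
  intro t ht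
  rcases hPN with rfl | rfl
  · exact hper P le_rfl t ⟨ht.1, by linarith [ht.2]⟩
  · have h2 := ht.2
    push_cast at h2
    rcases le_total t (N * (l₁ + l₂)) with h | h
    · exact hper N le_rfl t ⟨ht.1, h⟩
    · exact h₁ N (by omega) t ⟨h, by linarith⟩

theorem integral_le_of_bumps {l₁ l₂ X Y : ℝ} (hl₁ : 0 ≤ l₁) (hl₂ : 0 ≤ l₂) {P N : ℕ}
    (hPN : P = N ∨ P = N + 1) {g : ℝ → ℝ} (hg : ContinuousOn g (Set.Icc 0 (P * l₁ + N * l₂)))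
    (h₁ : ∀ k < P, ∫ x in (k * (l₁ + l₂))..(k * (l₁ + l₂) + l₁), g x ≤ X)
    (h₂ : ∀ k < N, ∫ x in (k * (l₁ + l₂) + l₁)..(k * (l₁ + l₂) + l₁ + l₂), g x ≤ Y) :
    ∫ x in (0 : ℝ)..(P * l₁ + N * l₂), g x ≤ P * X + N * Y := by
  have hNP : (N : ℝ) ≤ P := by
    rcases hPN with rfl | rfl
    · exact le_rfl
    · push_cast; linarith
  have hint {c d : ℝ} (hc : 0 ≤ c) (hcd : c ≤ d) (hd : d ≤ P * l₁ + N * l₂) :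
      IntervalIntegrable g volume c d :=
    (hg.mono (Set.Icc_subset_Icc hc hd)).intervalIntegrable_of_Icc hcd
  have hper : ∀ k ≤ N, ∫ x in (0 : ℝ)..(k * (l₁ + l₂)), g x ≤ k * (X + Y) := by
    intro k
    induction k with
    | zero => simp
    | succ k ih =>
      intro hk
      have hk' : (k : ℝ) + 1 ≤ N := by exact_mod_cast hk
      have hend : (k + 1) * (l₁ + l₂) ≤ P * l₁ + N * l₂ := by nlinarith
      have hx : 0 ≤ k * (l₁ + l₂) := by positivity
      have e : ((k + 1 : ℕ) : ℝ) * (l₁ + l₂) = k * (l₁ + l₂) + l₁ + l₂ := by push_cast; ring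
      rw [e, ← intervalIntegral.integral_add_adjacent_intervals
          (b := k * (l₁ + l₂) + l₁) (hint le_rfl (by linarith) (by linarith))
          (hint (by linarith) (by linarith) (by linarith)),
        ← intervalIntegral.integral_add_adjacent_intervals (b := k * (l₁ + l₂))
          (hint le_rfl hx (by linarith)) (hint hx (by linarith) (by linarith))]
      have h3 := ih (by omega)
      have h4 := h₁ k (by omega)
      have h5 := h₂ k (by omega)
      push_cast
      linarith
  rcases hPN with rfl | rfl
  · have h3 := hper P le_rfl
    rw [mul_add, mul_add] at h3
    exact h3
  · have hx : 0 ≤ N * (l₁ + l₂) := by positivity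
    have e : ((N + 1 : ℕ) : ℝ) * l₁ + N * l₂ = N * (l₁ + l₂) + l₁ := by push_cast; ring
    rw [e] at hint ⊢
    rw [← intervalIntegral.integral_add_adjacent_intervals (b := N * (l₁ + l₂))
      (hint le_rfl hx (by linarith)) (hint hx (by linarith) le_rfl)]
    have h3 := hper N le_rfl
    have h4 := h₁ N (by omega)
    push_cast
    linarith

/-! ### The distance of one bump from a sine -/

theorem integral_sin_sq_bump {p : ℝ} (hp : 0 < p) (A x₀ : ℝ) :
    ∫ x in x₀..(x₀ + Real.pi / p), (A * Real.sin (p * (x - x₀))) ^ 2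
      = A ^ 2 * (Real.pi / (2 * p)) := by
  simp_rw [mul_pow]
  rw [intervalIntegral.integral_const_mul]
  congr 1
  have h1 := intervalIntegral.integral_comp_mul_sub (a := x₀) (b := x₀ + Real.pi / p)
    (fun x => Real.sin x ^ 2) hp.ne' (p * x₀)
  simp_rw [← mul_sub] at h1
  rw [h1, add_sub_cancel_left, sub_self, mul_zero, mul_div_cancel₀ _ hp.ne', integral_sin_sq]
  simp
  field_simp

/-- The overlap of a bump of frequency `p` with `sin (n x)`. The factor is the cardinal sine
of `η = (π / 2) (1 - n / p)`, so that `p = n` needs no separate statement. -/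
theorem integral_sin_bump_mul_sin {p n : ℝ} (hp : 0 < p) (hn : 0 < n) (x₀ : ℝ) :
    ∫ x in x₀..(x₀ + Real.pi / p), Real.sin (p * (x - x₀)) * Real.sin (n * x)
      = Real.pi / (p + n) * Real.sinc (Real.pi / 2 * (1 - n / p))
        * Real.sin (n * (x₀ + Real.pi / (2 * p))) := by
  rcases eq_or_ne p n with rfl | hne
  · have hderiv (x : ℝ) : HasDerivAt
        (fun x => 1 / 2 * (x * Real.cos (p * x₀) - Real.sin (2 * p * x - p * x₀) / (2 * p)))
        (Real.sin (p * (x - x₀)) * Real.sin (p * x)) x := by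
      have h1 : HasDerivAt (fun x : ℝ => 2 * p * x - p * x₀) (2 * p * 1) x :=
        ((hasDerivAt_id x).const_mul (2 * p)).sub_const _
      refine ((((hasDerivAt_id x).mul_const (Real.cos (p * x₀))).sub
        (h1.sin.div_const (2 * p))).const_mul (1 / 2)).congr_deriv ?_
      have e1 : 2 * p * x - p * x₀ = p * (x - x₀) + p * x := by ring
      have e2 : p * x₀ = p * x - p * (x - x₀) := by ring
      rw [e1, Real.cos_add, congrArg Real.cos e2, Real.cos_sub]
      field_simp
      ring
    rw [intervalIntegral.integral_eq_sub_of_hasDerivAt (fun x _ => hderiv x)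
      (Continuous.intervalIntegrable (by fun_prop) _ _)]
    have e1 : 2 * p * (x₀ + Real.pi / p) - p * x₀ = p * x₀ + 2 * Real.pi := by
      field_simp; ring
    have e2 : 2 * p * x₀ - p * x₀ = p * x₀ := by ring
    have e3 : p * (x₀ + Real.pi / (2 * p)) = p * x₀ + Real.pi / 2 := by field_simp
    rw [e1, e2, e3, Real.sin_add_two_pi, Real.sin_add_pi_div_two, div_self hp.ne', sub_self,
      mul_zero, Real.sinc_zero]
    field_simp
    ring
  · have hpn : p ^ 2 - n ^ 2 ≠ 0 := by
      rw [sq_sub_sq]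
      exact mul_ne_zero (by positivity) (sub_ne_zero.2 hne)
    have hderiv (x : ℝ) : HasDerivAt
        (fun x => (n * (Real.sin (p * (x - x₀)) * Real.cos (n * x))
          - p * (Real.cos (p * (x - x₀)) * Real.sin (n * x))) / (p ^ 2 - n ^ 2))
        (Real.sin (p * (x - x₀)) * Real.sin (n * x)) x := by
      have h1 : HasDerivAt (fun x : ℝ => p * (x - x₀)) (p * 1) x :=
        ((hasDerivAt_id x).sub_const x₀).const_mul p
      have h2 : HasDerivAt (fun x : ℝ => n * x) (n * 1) x := (hasDerivAt_id x).const_mul n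
      refine ((((h1.sin.mul h2.cos).const_mul n).sub
        ((h1.cos.mul h2.sin).const_mul p)).div_const (p ^ 2 - n ^ 2)).congr_deriv ?_
      rw [div_eq_iff hpn]
      ring
    rw [intervalIntegral.integral_eq_sub_of_hasDerivAt (fun x _ => hderiv x)
      (Continuous.intervalIntegrable (by fun_prop) _ _)]
    rw [add_sub_cancel_left, sub_self, mul_zero, mul_div_cancel₀ _ hp.ne']
    have hη : Real.pi / 2 * (1 - n / p) ≠ 0 := by
      refine mul_ne_zero (by positivity) ?_
      rw [sub_ne_zero]
      intro h
      exact hne ((div_eq_one_iff_eq hp.ne').1 h.symm).symm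
    rw [Real.sinc_of_ne_zero hη]
    have e1 : Real.sin (Real.pi / 2 * (1 - n / p)) = Real.cos (n * (Real.pi / (2 * p))) := by
      rw [← Real.sin_pi_div_two_sub]
      congr 1
      field_simp
    have e2 : n * (x₀ + Real.pi / p)
        = n * (x₀ + Real.pi / (2 * p)) + n * (Real.pi / (2 * p)) := by
      field_simp; ring
    have e3 : n * x₀ = n * (x₀ + Real.pi / (2 * p)) - n * (Real.pi / (2 * p)) := by ring
    rw [e1, e2, e3, Real.sin_add, Real.sin_sub]
    have hpn' : p - n ≠ 0 := sub_ne_zero.2 hne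
    have e4 : Real.pi / 2 * (1 - n / p) = Real.pi * (p - n) / (2 * p) := by field_simp
    have e5 : p ^ 2 - n ^ 2 = (p + n) * (p - n) := by ring
    rw [e4, e5]
    simp only [Real.sin_pi, Real.cos_pi, Real.sin_zero, Real.cos_zero]
    field_simp
    ring

theorem one_sub_sq_div_six_le_sinc (x : ℝ) : 1 - x ^ 2 / 6 ≤ Real.sinc x := by
  wlog hx : 0 ≤ x generalizing x
  · have := this (-x) (by linarith)
    rwa [Real.sinc_neg, neg_sq] at this
  rcases hx.eq_or_lt with rfl | hx
  · simp
  · rw [Real.sinc_of_ne_zero hx.ne', le_div_iff₀ hx]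
    have := Real.sin_ge_sub_cube hx.le
    linarith

theorem one_sub_le_sinc_mul_cos {x d δ : ℝ} (hd : |d| ≤ δ) :
    1 - x ^ 2 / 6 - δ ^ 2 / 2 ≤ Real.sinc x * Real.cos d := by
  have h1 := one_sub_sq_div_six_le_sinc x
  have h2 := Real.one_sub_sq_div_two_le_cos (x := d)
  have h3 := Real.sinc_le_one x
  have h4 := Real.cos_le_one d
  have h5 : d ^ 2 ≤ δ ^ 2 := sq_le_sq' (abs_le.1 hd).1 (abs_le.1 hd).2
  nlinarith [mul_nonneg (sub_nonneg.2 h3) (sub_nonneg.2 h4)]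

/-- The contribution of one bump, of amplitude `A` and sign `σ`, to `∫ f² - 2 f sin (n x)`, when
the midpoint of the bump differs by the phase `d` from a maximum of `σ sin (n x)`. -/
theorem integral_bump_le {p n A x₀ d δ σ : ℝ} {u : ℝ → ℝ} (hp : 0 < p) (hn : 0 < n)
    (hA : 0 ≤ A) (hσ : σ ^ 2 = 1) (hd : |d| ≤ δ)
    (hmid : Real.sin (n * (x₀ + Real.pi / (2 * p))) = σ * Real.cos d)
    (hu : ∀ t ∈ Set.Icc x₀ (x₀ + Real.pi / p), u t = σ * (A * Real.sin (p * (t - x₀)))) :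
    ∫ x in x₀..(x₀ + Real.pi / p), (u x ^ 2 - 2 * (u x * Real.sin (n * x)))
      ≤ A ^ 2 * (Real.pi / (2 * p)) - 2 * A * (Real.pi / (p + n))
        * (1 - (Real.pi / 2 * (1 - n / p)) ^ 2 / 6 - δ ^ 2 / 2) := by
  have hle : x₀ ≤ x₀ + Real.pi / p := by
    have : 0 < Real.pi / p := by positivity
    linarith
  have h1 : ∫ x in x₀..(x₀ + Real.pi / p), (u x ^ 2 - 2 * (u x * Real.sin (n * x)))
      = ∫ x in x₀..(x₀ + Real.pi / p), ((A * Real.sin (p * (x - x₀))) ^ 2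
        - (2 * σ * A) * (Real.sin (p * (x - x₀)) * Real.sin (n * x))) := by
    refine intervalIntegral.integral_congr fun x hx => ?_
    rw [Set.uIcc_of_le hle] at hx
    simp only [hu x hx, mul_pow σ, hσ]
    ring
  rw [h1, intervalIntegral.integral_sub (Continuous.intervalIntegrable (by fun_prop) _ _)
    (Continuous.intervalIntegrable (by fun_prop) _ _), intervalIntegral.integral_const_mul,
    integral_sin_sq_bump hp, integral_sin_bump_mul_sin hp hn, hmid]
  have h2 := one_sub_le_sinc_mul_cos (x := Real.pi / 2 * (1 - n / p)) hd
  have h3 : 0 ≤ 2 * A * (Real.pi / (p + n)) := by positivity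
  have h4 := mul_le_mul_of_nonneg_left h2 h3
  have h5 : 2 * σ * A * (Real.pi / (p + n) * Real.sinc (Real.pi / 2 * (1 - n / p))
      * (σ * Real.cos d)) = σ ^ 2 * (2 * A * (Real.pi / (p + n))
        * (Real.sinc (Real.pi / 2 * (1 - n / p)) * Real.cos d)) := by ring
  rw [h5, hσ]
  linarith

/-! ### Normalization and phases -/

/-- The normalization of the supremum norm makes the slope at `0` the smaller frequency: the bumps
of that frequency have amplitude `1`. -/
theorem IsFucikTrajectory.slope_eq_min {p q s : ℝ} {u v : ℝ → ℝ} (hp : 0 < p) (hq : 0 < q)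
    (hs : 0 ≤ s) (h : IsFucikTrajectory (p ^ 2) (q ^ 2) 0 Real.pi u v) (hu : u 0 = 0)
    (hv : v 0 = s) {P N : ℕ} (hPN : P = N ∨ P = N + 1) (hN : 0 < N)
    (hlen : P * (Real.pi / p) + N * (Real.pi / q) = Real.pi)
    (hsup : IsLUB ((fun x => |u x|) '' Set.Icc 0 Real.pi) 1) : s = min p q := by
  have hl₁ : 0 < Real.pi / p := by positivity
  have hl₂ : 0 < Real.pi / q := by positivity
  have hNP : (N : ℝ) ≤ P := by
    rcases hPN with rfl | rfl
    · exact le_rfl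
    · push_cast; linarith
  have hN1 : (1 : ℝ) ≤ N := by exact_mod_cast hN
  have hpos (k : ℕ) (hk : k < P) : k * (Real.pi / p + Real.pi / q) + Real.pi / p ≤ Real.pi := by
    have h1 : (k : ℝ) + 1 ≤ P := by exact_mod_cast hk
    have h2 : (k : ℝ) ≤ N := by
      have : k ≤ N := by omega
      exact_mod_cast this
    nlinarith
  have hneg (k : ℕ) (hk : k < N) :
      k * (Real.pi / p + Real.pi / q) + Real.pi / p + Real.pi / q ≤ Real.pi := by
    have h1 : (k : ℝ) + 1 ≤ N := by exact_mod_cast hk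
    nlinarith
  have hmin : 0 < min p q := lt_min hp hq
  have hamp {c : ℝ} (hc : 0 < c) (hle : min p q ≤ c) (y : ℝ) :
      |s / c * Real.sin y| ≤ s / min p q := by
    rw [abs_mul, abs_of_nonneg (by positivity)]
    calc s / c * |Real.sin y| ≤ s / c * 1 := by gcongr; exact Real.abs_sin_le_one _
      _ ≤ s / min p q := by rw [mul_one]; gcongr
  have hub : ∀ t ∈ Set.Icc 0 (P * (Real.pi / p) + N * (Real.pi / q)), |u t| ≤ s / min p q := by
    refine forall_mem_Icc_of_bumps hPN (fun k hk t ht => ?_) (fun k hk t ht => ?_) ?_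
    · rw [h.eq_on_positive_bump hp hq hs hu hv k rfl (hpos k hk) t ht]
      exact hamp hp (min_le_left _ _) _
    · rw [h.eq_on_negative_bump hp hq hs hu hv k rfl (hneg k hk) t ht, abs_neg]
      exact hamp hq (min_le_right _ _) _
    · rw [hu, abs_zero]; positivity
  rw [hlen] at hub
  have h1 : 1 ≤ s / min p q := hsup.2 (by rintro _ ⟨t, ht, rfl⟩; exact hub t ht)
  have hP0 : 0 < P := by omega
  have h0p := hpos 0 hP0
  have h0q := hneg 0 hN
  simp only [Nat.cast_zero, zero_mul, zero_add] at h0p h0q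
  have hhalf {c : ℝ} (hc : 0 < c) : c * (Real.pi / (2 * c)) = Real.pi / 2 := by field_simp
  have hhalf' {c : ℝ} (hc : 0 < c) : Real.pi / (2 * c) ≤ Real.pi / c := by
    gcongr; linarith
  have hp' : 0 < Real.pi / (2 * p) := by positivity
  have hq' : 0 < Real.pi / (2 * q) := by positivity
  have h2 : s / p ≤ 1 := by
    have h3 := h.eq_on_positive_bump hp hq hs hu hv 0 rfl (by simpa using h0p)
      (Real.pi / (2 * p)) (by simpa using ⟨hp'.le, hhalf' hp⟩)
    simp only [Nat.cast_zero, zero_mul, sub_zero] at h3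
    rw [hhalf hp, Real.sin_pi_div_two, mul_one] at h3
    rw [← h3]
    exact (le_abs_self _).trans
      (hsup.1 ⟨Real.pi / (2 * p), ⟨hp'.le, (hhalf' hp).trans h0p⟩, rfl⟩)
  have h4 : s / q ≤ 1 := by
    have h3 := h.eq_on_negative_bump hp hq hs hu hv 0 (x₀ := Real.pi / p) (by simp) h0q
      (Real.pi / p + Real.pi / (2 * q)) ⟨by linarith, by linarith [hhalf' hq]⟩
    rw [add_sub_cancel_left, hhalf hq, Real.sin_pi_div_two, mul_one] at h3
    have h5 : |u (Real.pi / p + Real.pi / (2 * q))| ≤ 1 :=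
      hsup.1 ⟨_, ⟨by positivity, by linarith [hhalf' hq]⟩, rfl⟩
    rw [h3, abs_neg] at h5
    exact (le_abs_self _).trans h5
  rw [le_div_iff₀ hmin, one_mul] at h1
  rw [div_le_one hp] at h2
  rw [div_le_one hq] at h4
  exact le_antisymm (le_min h2 h4) h1

theorem abs_phase_le {t N y h : ℝ} (hN : 0 < N) (ht : 0 ≤ t) (htN : t ≤ N)
    (hy : y = 0 ∨ N * y = -h) : |t * y + h / 2| ≤ |h| / 2 := by
  rcases hy with rfl | hy
  · rw [mul_zero, zero_add, abs_div, abs_two]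
  · have h1 : t * y + h / 2 = h * (1 / 2 - t / N) := by
      field_simp
      linear_combination 2 * t * hy
    have h2 : t / N ≤ 1 := (div_le_one hN).2 htN
    have h3 : 0 ≤ t / N := by positivity
    rw [h1, abs_mul]
    have h4 : |1 / 2 - t / N| ≤ 1 / 2 := abs_le.2 ⟨by linarith, by linarith⟩
    nlinarith [abs_nonneg h]

/-- The midpoints of all bumps are close to the extrema of `sin (n x)`: the phase error is
constant or varies linearly along the interval, between the two opposite values
`± (π / 2) (1 - n / p)` at most. -/
theorem IsFucikTrajectory.integral_sq_sub_le {p q s : ℝ} {u v : ℝ → ℝ} (hp : 0 < p) (hq : 0 < q)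
    (hs : 0 ≤ s) (h : IsFucikTrajectory (p ^ 2) (q ^ 2) 0 Real.pi u v) (hu : u 0 = 0)
    (hv : v 0 = s) {P N : ℕ} (hPN : P = N ∨ P = N + 1) (hN : 0 < N)
    (hlen : P * (Real.pi / p) + N * (Real.pi / q) = Real.pi) {n : ℝ} (hn : n = P + N) :
    ∫ x in (0 : ℝ)..Real.pi, (u x ^ 2 - 2 * (u x * Real.sin (n * x)))
      ≤ P * ((s / p) ^ 2 * (Real.pi / (2 * p)) - 2 * (s / p) * (Real.pi / (p + n))
          * (1 - (Real.pi / 2 * (1 - n / p)) ^ 2 / 6 - (Real.pi / 2 * |1 - n / p|) ^ 2 / 2))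
        + N * ((s / q) ^ 2 * (Real.pi / (2 * q)) - 2 * (s / q) * (Real.pi / (q + n))
          * (1 - (Real.pi / 2 * (1 - n / q)) ^ 2 / 6 - (Real.pi / 2 * |1 - n / p|) ^ 2 / 2)) := by
  have hl₁ : 0 < Real.pi / p := by positivity
  have hl₂ : 0 < Real.pi / q := by positivity
  have hNP : (N : ℝ) ≤ P := by
    rcases hPN with rfl | rfl
    · exact le_rfl
    · push_cast; linarith
  have hN1 : (1 : ℝ) ≤ N := by exact_mod_cast hN
  have hn0 : 0 < n := by linarith
  set d₁ := n * (Real.pi / p) - Real.pi with hd₁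
  set y := n * (Real.pi / p + Real.pi / q) - 2 * Real.pi with hy
  have hphase : y = 0 ∨ N * y = -d₁ := by
    rcases hPN with rfl | rfl
    · left
      rw [hy, hn]
      linear_combination 2 * hlen
    · right
      push_cast at hlen hn
      rw [hy, hd₁, hn]
      linear_combination (2 * (N : ℝ) + 1) * hlen
  have hδ : |d₁| / 2 = Real.pi / 2 * |1 - n / p| := by
    have e : d₁ = Real.pi * -(1 - n / p) := by rw [hd₁]; field_simp; ring
    rw [e, abs_mul, abs_neg, abs_of_pos Real.pi_pos]
    ring
  conv_lhs => rw [← hlen]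
  refine integral_le_of_bumps hl₁.le hl₂.le hPN ?_ (fun k hk => ?_) (fun k hk => ?_)
  · rw [hlen]
    have := h.continuousOn_fst
    fun_prop
  · have h1 : (k : ℝ) + 1 ≤ P := by exact_mod_cast hk
    have h2 : (k : ℝ) ≤ N := by
      have : k ≤ N := by omega
      exact_mod_cast this
    refine integral_bump_le hp hn0 (by positivity) (σ := 1) (by norm_num)
      ((abs_phase_le (t := k) (by linarith) (by positivity) h2 hphase).trans_eq hδ) ?_ ?_
    · have e : n * (k * (Real.pi / p + Real.pi / q) + Real.pi / (2 * p))
          = (k * y + d₁ / 2) + Real.pi / 2 + k * (2 * Real.pi) := by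
        rw [hy, hd₁, ← div_div, div_right_comm]; ring
      rw [e, Real.sin_add_nat_mul_two_pi, Real.sin_add_pi_div_two, one_mul]
    · simp_rw [one_mul]
      exact h.eq_on_positive_bump hp hq hs hu hv k rfl (by nlinarith)
  · have h1 : (k : ℝ) + 1 ≤ N := by exact_mod_cast hk
    refine integral_bump_le hq hn0 (by positivity) (σ := -1) (by norm_num)
      ((abs_phase_le (t := k + 1 / 2) (by linarith) (by positivity) (by linarith)
        hphase).trans_eq hδ) ?_ ?_
    · have e : n * (k * (Real.pi / p + Real.pi / q) + Real.pi / p + Real.pi / (2 * q))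
          = ((k + 1 / 2) * y + d₁ / 2) + Real.pi / 2 + Real.pi + k * (2 * Real.pi) := by
        rw [hy, hd₁, ← div_div Real.pi 2 q, div_right_comm]; ring
      rw [e, Real.sin_add_nat_mul_two_pi, Real.sin_add_pi, Real.sin_add_pi_div_two, neg_one_mul]
    · simp_rw [neg_one_mul]
      exact h.eq_on_negative_bump hp hq hs hu hv k rfl (by nlinarith)

/-! ### The distance of a Fučík eigenfunction from a sine -/

/-- The rational inequality behind the distance estimate. Here `a ≥ 1 ≥ b` are the two
frequencies in units of `n = P + Q`, carried by `P` and `Q` bumps. The terms of first order in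
`a - 1` cancel by the relation `P (1 - 1 / a) = Q (1 / b - 1)`. -/
theorem bump_sum_le {a b P Q z r₁ r₂ : ℝ} (ha : 1 ≤ a) (hb : 0 < b) (hb1 : b ≤ 1) (hP : 0 < P)
    (hQ : 0 < Q) (hPQ : P ≤ 2 * Q) (hz : 0 ≤ z) (hlen : P / a + Q / b = P + Q)
    (hr₁ : r₁ ≤ z * (1 - 1 / a) ^ 2) (hr₂ : r₂ ≤ z * (1 / b - 1) ^ 2) :
    (P + Q) / 2 + P * ((b / a) ^ 2 / (2 * a) - 2 * (b / a) / (a + 1) * (1 - r₁))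
        + Q * (1 / (2 * b) - 2 / (b + 1) * (1 - r₂))
      ≤ (a - 1) ^ 2 * (P / Q) * (P + Q) * ((P + Q) / (2 * Q) + 3 / 4 + z) := by
  have ha0 : 0 < a := by linarith
  set x := 1 - 1 / a with hx
  set w := (P + Q) / Q with hw
  have hx0 : 0 ≤ x := by rw [hx, sub_nonneg, div_le_one ha0]; exact ha
  have hxa : x * a = a - 1 := by rw [hx]; field_simp
  have hw0 : 0 < w := by positivity
  have hw1 : w = P / Q + 1 := by rw [hw]; field_simp
  have hwx : 1 / b - 1 / a = w * x := by
    rw [hw, hx]; field_simp at hlen ⊢; linear_combination hlen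
  have hyx : 1 / b - 1 = P / Q * x := by
    rw [hw1] at hwx; linear_combination hwx - hx
  have hκ : P / Q ≤ 2 := (div_le_iff₀ hQ).2 hPQ
  have hκ0 : 0 < P / Q := by positivity
  have hxD : x ≤ a - 1 := by nlinarith
  have hD0 : 0 ≤ a - 1 := by linarith
  have hA : 1 - b / a = b * (w * x) := by rw [← hwx]; field_simp
  have hA1 : b / a ≤ 1 := (div_le_one ha0).2 (by linarith)
  -- the quadratic part of the amplitude defect
  have hT₁ : P * ((1 - b / a) ^ 2 / (2 * a)) ≤ P * (w ^ 2 * (a - 1) ^ 2 / 2) := by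
    gcongr ?_ * ?_
    rw [hA]
    have h1 : (b * (w * x)) ^ 2 ≤ w ^ 2 * (a - 1) ^ 2 := by
      calc (b * (w * x)) ^ 2 ≤ (1 * (w * (a - 1))) ^ 2 := by gcongr
        _ = w ^ 2 * (a - 1) ^ 2 := by ring
    calc (b * (w * x)) ^ 2 / (2 * a) ≤ (w ^ 2 * (a - 1) ^ 2) / (2 * 1) := by gcongr
      _ = _ := by ring
  -- what the first order terms leave
  have hT₂ : P * (x * (1 / (b + 1) - b / a / (a + 1)))
      ≤ P * ((a - 1) * (3 / 4 * (w * (a - 1)))) := by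
    have e : 1 / (b + 1) - b / a / (a + 1)
        = b / (b + 1) * (1 + b / (a + 1)) * (w * x) := by
      rw [← hwx]; field_simp; ring
    have h1 : b / (b + 1) ≤ 1 / 2 := by rw [div_le_iff₀ (by linarith)]; linarith
    have h2 : b / (a + 1) ≤ 1 / 2 := by rw [div_le_iff₀ (by linarith)]; linarith
    rw [e]
    have h3 : b / (b + 1) * (1 + b / (a + 1)) ≤ 3 / 4 := by
      calc b / (b + 1) * (1 + b / (a + 1)) ≤ 1 / 2 * (1 + 1 / 2) := by gcongr
        _ = 3 / 4 := by norm_num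
    gcongr
  -- the phase errors
  have hT₃ : P * (2 * (b / a) / (a + 1) * r₁) ≤ P * (z * (a - 1) ^ 2) := by
    gcongr ?_ * ?_
    have h1 : 2 * (b / a) / (a + 1) ≤ 1 := by rw [div_le_one (by linarith)]; linarith
    have h0 : 0 ≤ 2 * (b / a) / (a + 1) := by positivity
    calc 2 * (b / a) / (a + 1) * r₁ ≤ 2 * (b / a) / (a + 1) * (z * x ^ 2) := by gcongr
      _ ≤ 1 * (z * (a - 1) ^ 2) := by gcongr
      _ = _ := one_mul _
  have hT₄ : Q * (2 / (b + 1) * r₂) ≤ P * (P / Q * (z * (a - 1) ^ 2)) := by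
    have h1 : 2 / (b + 1) ≤ a := by
      have hb' : (1 + P / Q * x) * b = 1 := by
        rw [← hyx]; field_simp; ring
      rw [div_le_iff₀ (by linarith)]
      -- `b = 1 / (1 + κ x)` and `a = 1 / (1 - x)`, where `κ = P / Q ≤ 2`
      have h2 : P / Q * x * b ≤ 2 * x := by
        have : P / Q * x * b ≤ 2 * x * 1 := by gcongr
        linarith
      nlinarith
    have h0 : 0 ≤ 2 / (b + 1) := by positivity
    calc Q * (2 / (b + 1) * r₂) ≤ Q * (2 / (b + 1) * (z * (P / Q * x) ^ 2)) := by
          rw [← hyx]; gcongr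
      _ ≤ Q * (a * (z * (P / Q * x) ^ 2)) := by gcongr
      _ = P * (P / Q * (z * (x * (x * a)))) := by field_simp
      _ ≤ P * (P / Q * (z * ((a - 1) * (x * a)))) := by
          have : 0 ≤ x * a := by positivity
          gcongr
      _ = _ := by rw [hxa]; ring
  have hQ₁ : Q * (1 / b - 2 / (b + 1)) = P * (x * (1 / (b + 1))) := by
    have e : 1 / b - 2 / (b + 1) = (1 / b - 1) * (1 / (b + 1)) := by field_simp; ring
    rw [e, hyx]; field_simp
  have hP₁ : 1 / (2 * a) + (b / a) ^ 2 / (2 * a) - 2 * (b / a) / (a + 1)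
      = (1 - b / a) ^ 2 / (2 * a) - x * (b / a / (a + 1)) := by
    rw [hx]; field_simp; ring
  have hL : (P + Q) / 2 = P * (1 / (2 * a)) + Q * (1 / (2 * b)) := by
    rw [← hlen]; field_simp
  have hQ₂ : 1 / (2 * b) + 1 / (2 * b) = 1 / b := by field_simp; ring
  calc _ = P * ((1 - b / a) ^ 2 / (2 * a)) + P * (x * (1 / (b + 1) - b / a / (a + 1)))
        + P * (2 * (b / a) / (a + 1) * r₁) + Q * (2 / (b + 1) * r₂) := by
        rw [hL]
        linear_combination P * hP₁ + hQ₁ + Q * hQ₂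
    _ ≤ P * (w ^ 2 * (a - 1) ^ 2 / 2) + P * ((a - 1) * (3 / 4 * (w * (a - 1))))
        + P * (z * (a - 1) ^ 2) + P * (P / Q * (z * (a - 1) ^ 2)) := by linarith
    _ = _ := by rw [hw]; field_simp; ring

/-- The estimate for the sum of the contributions of all bumps, with amplitudes `lo / hi` and `1`;
here `δ` bounds the phase errors. -/
theorem bump_contributions_le {hi lo P Q n δ : ℝ} (hlo : 0 < lo) (hle : lo ≤ hi) (hP : 0 < P)
    (hQ : 0 < Q) (hPQ : P ≤ 2 * Q) (hn : n = P + Q) (hlen : P / hi + Q / lo = 1)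
    (hδ₁ : δ ^ 2 ≤ (Real.pi / 2 * (1 - n / hi)) ^ 2)
    (hδ₂ : δ ^ 2 ≤ (Real.pi / 2 * (1 - n / lo)) ^ 2) :
    n ≤ hi ∧
    P * ((lo / hi) ^ 2 * (Real.pi / (2 * hi)) - 2 * (lo / hi) * (Real.pi / (hi + n))
          * (1 - (Real.pi / 2 * (1 - n / hi)) ^ 2 / 6 - δ ^ 2 / 2))
        + Q * (1 ^ 2 * (Real.pi / (2 * lo)) - 2 * 1 * (Real.pi / (lo + n))
          * (1 - (Real.pi / 2 * (1 - n / lo)) ^ 2 / 6 - δ ^ 2 / 2)) + Real.pi / 2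
      ≤ (hi / n - 1) ^ 2 * (Real.pi * (P / Q) * (n / (2 * Q) + 3 / 4 + Real.pi ^ 2 / 6)) := by
  have hn0 : 0 < n := by linarith
  have hhi : 0 < hi := by linarith
  have hpi := Real.pi_pos
  obtain ⟨a, rfl⟩ : ∃ a, hi = n * a := ⟨hi / n, by field_simp⟩
  obtain ⟨b, rfl⟩ : ∃ b, lo = n * b := ⟨lo / n, by field_simp⟩
  have ha0 : 0 < a := pos_of_mul_pos_right hhi hn0.le
  have hb0 : 0 < b := pos_of_mul_pos_right hlo hn0.le
  have hba : b ≤ a := le_of_mul_le_mul_left hle hn0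
  have hlab : P / a + Q / b = P + Q := by
    rw [← hn]
    have e : P / a + Q / b = n * (P / (n * a) + Q / (n * b)) := by field_simp
    rw [e, hlen, mul_one]
  have ha1 : 1 ≤ a := by
    by_contra! hlt
    have h1 : P < P / a := (lt_div_iff₀ ha0).2 (by nlinarith)
    have h2 : Q < Q / b := (lt_div_iff₀ hb0).2 (by nlinarith)
    linarith
  have hb1 : b ≤ 1 := by
    by_contra! hlt
    have h1 : P / a ≤ P := (div_le_iff₀ ha0).2 (by nlinarith)
    have h2 : Q / b < Q := (div_lt_iff₀ hb0).2 (by nlinarith)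
    linarith
  refine ⟨by nlinarith, ?_⟩
  have hna : n / (n * a) = 1 / a := by field_simp
  have hnb : n / (n * b) = 1 / b := by field_simp
  have hab : n * b / (n * a) = b / a := by field_simp
  rw [hna] at hδ₁ ⊢
  rw [hnb] at hδ₂ ⊢
  rw [hab, mul_div_cancel_left₀ _ hn0.ne']
  have hbump := bump_sum_le (z := Real.pi ^ 2 / 6)
    (r₁ := (Real.pi / 2 * (1 - 1 / a)) ^ 2 / 6 + δ ^ 2 / 2)
    (r₂ := (Real.pi / 2 * (1 - 1 / b)) ^ 2 / 6 + δ ^ 2 / 2)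
    ha1 hb0 hb1 hP hQ hPQ (by positivity) hlab (by linear_combination (1 / 2) * hδ₁)
    (by linear_combination (1 / 2) * hδ₂)
  have h1 := mul_le_mul_of_nonneg_left hbump (show 0 ≤ Real.pi / n by positivity)
  generalize (Real.pi / 2 * (1 - 1 / a)) ^ 2 / 6 = ρ₁ at h1 ⊢
  generalize (Real.pi / 2 * (1 - 1 / b)) ^ 2 / 6 = ρ₂ at h1 ⊢
  rw [← hn] at h1
  have e1 : Real.pi / (2 * (n * a)) = Real.pi / n * (1 / (2 * a)) := by field_simp
  have e2 : Real.pi / (2 * (n * b)) = Real.pi / n * (1 / (2 * b)) := by field_simp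
  have e3 : Real.pi / (n * a + n) = Real.pi / n * (1 / (a + 1)) := by field_simp
  have e4 : Real.pi / (n * b + n) = Real.pi / n * (1 / (b + 1)) := by field_simp
  have e5 : Real.pi / 2 = Real.pi / n * (n / 2) := by field_simp
  have e6 : Real.pi / n * n = Real.pi := by field_simp
  rw [e1, e2, e3, e4, e5]
  refine (le_of_eq ?_).trans (h1.trans_eq ?_)
  · ring
  · linear_combination (a - 1) ^ 2 * (P / Q) * (n / (2 * Q) + 3 / 4 + Real.pi ^ 2 / 6) * e6

theorem IsFucikTrajectory.integral_sub_sin_sq_eq {α β : ℝ} {u v : ℝ → ℝ}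
    (h : IsFucikTrajectory α β 0 Real.pi u v) {n : ℕ} (hn : 0 < n) :
    ∫ x in (0 : ℝ)..Real.pi, (u x - Real.sin (n * x)) ^ 2
      = (∫ x in (0 : ℝ)..Real.pi, (u x ^ 2 - 2 * (u x * Real.sin (n * x)))) + Real.pi / 2 := by
  have h1 : ∫ x in (0 : ℝ)..Real.pi, Real.sin (n * x) * Real.sin (n * x) = Real.pi / 2 :=
    (integral_sin_natCast_mul_sin_natCast ⟨n, hn⟩ ⟨n, hn⟩).trans (if_pos rfl)
  have hc := h.continuousOn_fst
  rw [← h1, ← intervalIntegral.integral_add]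
  · exact intervalIntegral.integral_congr fun x _ => by ring
  · refine ContinuousOn.intervalIntegrable_of_Icc Real.pi_pos.le ?_
    fun_prop
  · exact Continuous.intervalIntegrable (by fun_prop) _ _

/-- The squared distance to `sin (n x)` is of second order in the deviation of the larger
frequency from `n`. -/
theorem IsFucikTrajectory.integral_sub_sin_sq_le {p q s : ℝ} {u v : ℝ → ℝ} (hp : 0 < p)
    (hq : 0 < q) (hs : 0 ≤ s) (h : IsFucikTrajectory (p ^ 2) (q ^ 2) 0 Real.pi u v) (hu : u 0 = 0)
    (hv : v 0 = s) {P N : ℕ} (hPN : P = N ∨ P = N + 1) (hN : 0 < N)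
    (hlen : P * (Real.pi / p) + N * (Real.pi / q) = Real.pi)
    (hsup : IsLUB ((fun x => |u x|) '' Set.Icc 0 Real.pi) 1) {n : ℕ} (hn : P + N = n) :
    (q ≤ p → (n : ℝ) ≤ p ∧ ∫ x in (0 : ℝ)..Real.pi, (u x - Real.sin (n * x)) ^ 2
      ≤ (p / n - 1) ^ 2 * (Real.pi * (P / N) * (n / (2 * N) + 3 / 4 + Real.pi ^ 2 / 6))) ∧
    (p ≤ q → (n : ℝ) ≤ q ∧ ∫ x in (0 : ℝ)..Real.pi, (u x - Real.sin (n * x)) ^ 2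
      ≤ (q / n - 1) ^ 2 * (Real.pi * (N / P) * (n / (2 * P) + 3 / 4 + Real.pi ^ 2 / 6))) := by
  have hNP : (N : ℝ) ≤ P := by
    rcases hPN with rfl | rfl
    · exact le_rfl
    · push_cast; linarith
  have hN1 : (1 : ℝ) ≤ N := by exact_mod_cast hN
  have hPN1 : (P : ℝ) ≤ N + 1 := by
    rcases hPN with rfl | rfl
    · linarith
    · push_cast; linarith
  have hnPN : (n : ℝ) = P + N := by exact_mod_cast hn.symm
  have hP0 : (0 : ℝ) < P := by linarith
  have hN0 : (0 : ℝ) < N := by linarith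
  have hpq : P / p + N / q = 1 := by
    have e : Real.pi * (P / p + N / q) = Real.pi * 1 := by linear_combination hlen
    exact mul_left_cancel₀ Real.pi_ne_zero e
  -- the positive bumps are at least as many, so their frequency deviates less
  have habs : |1 - n / p| ≤ |1 - n / q| := by
    have e : P * (1 - n / p) = N * -(1 - n / q) := by
      rw [hnPN]
      linear_combination -(P + N : ℝ) * hpq
    have e' := congrArg abs e
    rw [abs_mul, abs_mul, abs_neg, Nat.abs_cast, Nat.abs_cast] at e'
    by_contra! hlt
    nlinarith [abs_nonneg (1 - n / q)]
  have hδp : (Real.pi / 2 * |1 - n / p|) ^ 2 ≤ (Real.pi / 2 * (1 - n / p)) ^ 2 := by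
    rw [mul_pow, sq_abs, mul_pow]
  have hδq : (Real.pi / 2 * |1 - n / p|) ^ 2 ≤ (Real.pi / 2 * (1 - n / q)) ^ 2 := by
    rw [mul_pow, mul_pow, ← sq_abs (1 - n / q)]
    gcongr
  have hsmin := h.slope_eq_min hp hq hs hu hv hPN hN hlen hsup
  have hmain := h.integral_sq_sub_le hp hq hs hu hv hPN hN hlen hnPN
  rw [h.integral_sub_sin_sq_eq (by omega)]
  constructor
  · intro hle
    rw [hsmin, min_eq_right hle, div_self hq.ne'] at hmain
    obtain ⟨h1, h2⟩ := bump_contributions_le hq hle hP0 hN0 (by linarith) hnPN hpq hδp hδq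
    exact ⟨h1, by linarith⟩
  · intro hle
    rw [hsmin, min_eq_left hle, div_self hp.ne'] at hmain
    obtain ⟨h1, h2⟩ := bump_contributions_le hp hle hN0 hP0 (by linarith)
      (hnPN.trans (add_comm _ _)) ((add_comm _ _).trans hpq) hδq hδp
    exact ⟨h1, by linarith⟩

/-! ### The constants -/

/-- On `Γ_n` there are `⌈n / 2⌉` positive and `⌊n / 2⌋` negative bumps, filling `[0, π]`. -/
theorem exists_bump_counts {n : ℕ} (hn : 2 ≤ n) {α β : ℝ} (h : (α, β) ∈ fucikCurve n) :
    ∃ P N : ℕ, (Even n ∧ P = N ∨ Odd n ∧ P = N + 1) ∧ 0 < N ∧ P + N = n ∧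
      P * (Real.pi / √α) + N * (Real.pi / √β) = Real.pi := by
  obtain ⟨-, -, ⟨he, hlen⟩ | ⟨ho, hlen⟩⟩ := h
  · obtain ⟨N, rfl⟩ := he
    refine ⟨N, N, Or.inl ⟨⟨N, rfl⟩, rfl⟩, by omega, rfl, ?_⟩
    push_cast at hlen
    linear_combination hlen
  · obtain ⟨N, rfl⟩ := ho
    refine ⟨N + 1, N, Or.inr ⟨⟨N, rfl⟩, rfl⟩, by omega, by ring, ?_⟩
    push_cast at hlen ⊢
    linear_combination hlen

theorem pi_sq_div_six_le : Real.pi ^ 2 / 6 ≤ 33 / 20 := by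
  have h1 := Real.pi_lt_d4
  have h2 := Real.pi_pos
  nlinarith

/-- The constant for even `n` dominates the distance estimate. -/
theorem even_constant_le :
    Real.pi * (1 + 3 / 4 + Real.pi ^ 2 / 6) * (9 / (8 * (3 + Real.pi ^ 2))) ≤ Real.pi / 2 := by
  have h1 := Real.pi_gt_three
  have h2 : (1 + 3 / 4 + Real.pi ^ 2 / 6) * (9 / (8 * (3 + Real.pi ^ 2))) ≤ 1 / 2 := by
    rw [mul_div_assoc', div_le_iff₀ (by positivity)]
    nlinarith
  rw [mul_assoc]
  calc Real.pi * _ ≤ Real.pi * (1 / 2) := by gcongr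
    _ = _ := by ring

/-- The constant for odd `n = 2 m + 1` with `α ≥ β` dominates the distance estimate. -/
theorem odd_constant_le_of_ge {m n : ℝ} (hm : 1 ≤ m) (hn : n = 2 * m + 1) :
    Real.pi * ((m + 1) / m) * (n / (2 * m) + 3 / 4 + Real.pi ^ 2 / 6)
      * ((n - 1) ^ 4 / (8 * n ^ 2 * (n ^ 2 + 1))) ≤ Real.pi / 2 := by
  have hz := pi_sq_div_six_le
  have hn0 : 0 < n := by linarith
  have hm0 : 0 < m := by linarith
  have h2 : ((m + 1) / m) * (n / (2 * m) + 3 / 4 + 33 / 20)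
      * ((n - 1) ^ 4 / (8 * n ^ 2 * (n ^ 2 + 1))) ≤ 1 / 2 := by
    have e : ((m + 1) / m) * (n / (2 * m) + 3 / 4 + 33 / 20)
      * ((n - 1) ^ 4 / (8 * n ^ 2 * (n ^ 2 + 1)))
      = (m + 1) * (n + 24 / 5 * m) * m ^ 2 / (n ^ 2 * (n ^ 2 + 1)) := by
      have : n - 1 = 2 * m := by linarith
      rw [this]; field_simp; ring
    rw [e, div_le_iff₀ (by positivity), hn]
    nlinarith [pow_pos hm0 3, pow_pos hm0 4, pow_pos hm0 2]
  calc _ = Real.pi * (((m + 1) / m) * (n / (2 * m) + 3 / 4 + Real.pi ^ 2 / 6)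
      * ((n - 1) ^ 4 / (8 * n ^ 2 * (n ^ 2 + 1)))) := by ring
    _ ≤ Real.pi * (((m + 1) / m) * (n / (2 * m) + 3 / 4 + 33 / 20)
      * ((n - 1) ^ 4 / (8 * n ^ 2 * (n ^ 2 + 1)))) := by gcongr
    _ ≤ Real.pi * (1 / 2) := by gcongr
    _ = _ := by ring

/-- The constant for odd `n = 2 m + 1` with `α < β` dominates the distance estimate. -/
theorem odd_constant_le_of_lt {m n : ℝ} (hm : 1 ≤ m) (hn : n = 2 * m + 1) :
    Real.pi * (m / (m + 1)) * (n / (2 * (m + 1)) + 3 / 4 + Real.pi ^ 2 / 6)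
      * ((n + 1) ^ 4 / (10 * n ^ 2 * (n ^ 2 + 1))) ≤ Real.pi / 2 := by
  have hz := pi_sq_div_six_le
  have hn0 : 0 < n := by linarith
  have hm0 : 0 < m := by linarith
  have h2 : (m / (m + 1)) * (n / (2 * (m + 1)) + 3 / 4 + 33 / 20)
      * ((n + 1) ^ 4 / (10 * n ^ 2 * (n ^ 2 + 1))) ≤ 1 / 2 := by
    have e : (m / (m + 1)) * (n / (2 * (m + 1)) + 3 / 4 + 33 / 20)
      * ((n + 1) ^ 4 / (10 * n ^ 2 * (n ^ 2 + 1)))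
      = 4 * m * (n + 24 / 5 * (m + 1)) * (m + 1) ^ 2 / (5 * n ^ 2 * (n ^ 2 + 1)) := by
      have : n + 1 = 2 * (m + 1) := by linarith
      rw [this]; field_simp; ring
    rw [e, div_le_iff₀ (by positivity), hn]
    obtain ⟨k, rfl⟩ : ∃ k, m = k + 1 := ⟨m - 1, by ring⟩
    have hk : 0 ≤ k := by linarith
    nlinarith [pow_nonneg hk 3, pow_nonneg hk 4, pow_nonneg hk 2]
  calc _ = Real.pi * ((m / (m + 1)) * (n / (2 * (m + 1)) + 3 / 4 + Real.pi ^ 2 / 6)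
      * ((n + 1) ^ 4 / (10 * n ^ 2 * (n ^ 2 + 1)))) := by ring
    _ ≤ Real.pi * ((m / (m + 1)) * (n / (2 * (m + 1)) + 3 / 4 + 33 / 20)
      * ((n + 1) ^ 4 / (10 * n ^ 2 * (n ^ 2 + 1)))) := by gcongr
    _ ≤ Real.pi * (1 / 2) := by gcongr
    _ = _ := by ring

/-- The bound `M ≤ n + √c n ^ ((1 - ε) / 2)` in units of `n`. -/
theorem sq_div_sub_one_le {n M c ε : ℝ} (hn : 0 < n) (hnM : n ≤ M) (hc : 0 ≤ c)
    (hM : M ≤ n + √c * n ^ ((1 - ε) / 2)) : (M / n - 1) ^ 2 ≤ c * (1 / n ^ (1 + ε)) := by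
  have h1 : (M - n) ^ 2 ≤ (√c * n ^ ((1 - ε) / 2)) ^ 2 :=
    pow_le_pow_left₀ (by linarith) (by linarith) 2
  have h2 : (n ^ ((1 - ε) / 2)) ^ 2 = n ^ (1 - ε) := by
    rw [← Real.rpow_natCast, ← Real.rpow_mul hn.le]
    congr 1
    push_cast
    ring
  have h3 : n ^ (1 - ε) = n ^ 2 * (1 / n ^ (1 + ε)) := by
    rw [show 1 - ε = 2 - (1 + ε) by ring, Real.rpow_sub hn, Real.rpow_two]
    ring
  rw [mul_pow, Real.sq_sqrt hc, h2, h3] at h1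
  have e : (M / n - 1) ^ 2 = (M - n) ^ 2 / n ^ 2 := by field_simp
  rw [e, div_le_iff₀ (by positivity)]
  linarith

/-- The terms `n ^ (-s)`, `n ≥ 2`, sum to `ζ(s) - 1`. -/
theorem hasSum_zeta_sub_one {s : ℝ} (hs : 1 < s) :
    HasSum (fun n : ℕ+ => if (n : ℕ) = 1 then 0 else 1 / ((n : ℕ) : ℝ) ^ s)
      ((riemannZeta (s : ℂ)).re - 1) := by
  have h1 : Summable fun n : ℕ => 1 / (n : ℝ) ^ s := Real.summable_one_div_nat_rpow.2 hs
  have h2 : (riemannZeta (s : ℂ)).re = ∑' n : ℕ, 1 / (n : ℝ) ^ s := by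
    rw [zeta_eq_tsum_one_div_nat_cpow (by simpa using hs)]
    have : ∀ n : ℕ, 1 / (n : ℂ) ^ (s : ℂ) = ((1 / (n : ℝ) ^ s : ℝ) : ℂ) := by
      intro n
      rw [← Complex.ofReal_natCast, ← Complex.ofReal_cpow (Nat.cast_nonneg n)]
      push_cast
      rfl
    simp_rw [this]
    rw [← Complex.ofReal_tsum, Complex.ofReal_re]
  have h3 : HasSum (fun n : ℕ => 1 / (n : ℝ) ^ s) (riemannZeta (s : ℂ)).re := h2 ▸ h1.hasSum
  have h4 : HasSum (fun n : ℕ => if n = 1 then (0 : ℝ) else 1 / (n : ℝ) ^ s)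
      ((riemannZeta (s : ℂ)).re - 1) := by
    refine (h3.sub (hasSum_ite_eq (1 : ℕ) (1 : ℝ))).congr_fun fun n => ?_
    split_ifs with h
    · simp [h]
    · simp
  refine (PNat.coe_injective.hasSum_iff (f := fun n : ℕ => if n = 1 then (0 : ℝ)
    else 1 / (n : ℝ) ^ s) fun n hn => ?_).2 h4
  obtain rfl : n = 0 := by
    by_contra h0
    exact hn ⟨⟨n, Nat.pos_of_ne_zero h0⟩, rfl⟩
  simp [Real.zero_rpow (by linarith : s ≠ 0)]

theorem zeta_sub_one_pos {s : ℝ} (hs : 1 < s) : 0 < (riemannZeta (s : ℂ)).re - 1 := by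
  refine hasSum_lt (f := fun _ : ℕ+ => (0 : ℝ)) (fun n => ?_) (i := 2) ?_ hasSum_zero
    (hasSum_zeta_sub_one hs)
  · split_ifs
    · exact le_rfl
    · positivity
  · norm_num
    positivity

/-! ### The Riesz basis -/

theorem norm_sq_toL2_sub_sineL2 {𝕜 : Type*} [RCLike 𝕜] {α β : ℕ → ℝ} {f : ℕ → ℝ → ℝ}
    (hF : IsFucikSystem α β f) (n : ℕ+) :
    ‖hF.toL2 𝕜 n - sineL2 𝕜 n‖ ^ 2
      = ∫ x in (0 : ℝ)..Real.pi, (f n x - Real.sin (n * x)) ^ 2 := by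
  have h1 : inner 𝕜 (hF.toL2 𝕜 n - sineL2 𝕜 n) (hF.toL2 𝕜 n - sineL2 𝕜 n)
      = ((∫ x in Set.Ioo 0 Real.pi, (f n x - Real.sin (n * x)) ^ 2 : ℝ) : 𝕜) := by
    rw [L2.inner_def, ← integral_ofReal]
    refine integral_congr_ae ?_
    filter_upwards [Lp.coeFn_sub (hF.toL2 𝕜 n) (sineL2 𝕜 n), (hF.memLp 𝕜 n).coeFn_toLp,
      (memLp_ofReal_sin 𝕜 n).coeFn_toLp] with x h2 h3 h4
    rw [h2, Pi.sub_apply, IsFucikSystem.toL2, sineL2, h3, h4, ← RCLike.ofReal_sub,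
      RCLike.inner_apply, RCLike.conj_ofReal, ← RCLike.ofReal_mul, sq]
  rw [intervalIntegral.integral_of_le Real.pi_pos.le, integral_Ioc_eq_integral_Ioo]
  rw [inner_self_eq_norm_sq_to_K] at h1
  exact_mod_cast h1

theorem lt_pi_div_two_mul_of_le_mul {E C t c B K Z : ℝ} (hE : E ≤ t * C) (hC : 0 < C)
    (ht : t ≤ c * K) (hK : 0 < K) (hc : c < B * (1 / Z)) (hZ : 0 < Z) (hCB : C * B ≤ Real.pi / 2) :
    E < Real.pi / 2 * (K / Z) := by
  calc E ≤ t * C := hE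
    _ ≤ c * K * C := by gcongr
    _ < B * (1 / Z) * K * C := by gcongr
    _ = C * B * (K / Z) := by ring
    _ ≤ Real.pi / 2 * (K / Z) := by gcongr

theorem corollary1 {𝕜 : Type*} [RCLike 𝕜] (α β : ℕ → ℝ) (f : ℕ → ℝ → ℝ)
    (hF : IsFucikSystem α β f) (ε : ℝ) (hε : 0 < ε) (c : ℕ → ℝ)
    (hc_nonneg : ∀ n : ℕ, 2 ≤ n → 0 ≤ c n)
    (hmax : ∀ n : ℕ, 2 ≤ n →
      max (√(α n)) (√(β n)) ≤ (n : ℝ) + √(c n) * (n : ℝ) ^ ((1 - ε) / 2))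
    (hc_even : ∀ n : ℕ, 2 ≤ n → Even n →
      c n < 9 / (8 * (3 + Real.pi ^ 2)) *
        (1 / ((riemannZeta ((1 + ε : ℝ) : ℂ)).re - 1)))
    (hc_odd_ge : ∀ n : ℕ, 2 ≤ n → Odd n → β n ≤ α n →
      c n < ((n : ℝ) - 1) ^ 4 / (8 * (n : ℝ) ^ 2 * ((n : ℝ) ^ 2 + 1)) *
        (1 / ((riemannZeta ((1 + ε : ℝ) : ℂ)).re - 1)))
    (hc_odd_lt : ∀ n : ℕ, 2 ≤ n → Odd n → α n < β n →
      c n < ((n : ℝ) + 1) ^ 4 / (10 * (n : ℝ) ^ 2 * ((n : ℝ) ^ 2 + 1)) *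
        (1 / ((riemannZeta ((1 + ε : ℝ) : ℂ)).re - 1))) :
    IsRieszBasis 𝕜 (hF.toL2 𝕜) := by
  have hs : 1 < 1 + ε := by linarith
  set Z := (riemannZeta ((1 + ε : ℝ) : ℂ)).re - 1 with hZdef
  have hZ : 0 < Z := zeta_sub_one_pos hs
  have hdist (n : ℕ) (hn : 2 ≤ n) : ∫ x in (0 : ℝ)..Real.pi, (f n x - Real.sin (n * x)) ^ 2
      < Real.pi / 2 * (1 / (n : ℝ) ^ (1 + ε) / Z) := by
    have hmem := hF.mem_curve n hn
    obtain ⟨P, N, hcase, hN, hPNn, hlen⟩ := exists_bump_counts hn hmem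
    obtain ⟨hsol, hslope, hsup⟩ := hF.eigenfunction n hn
    have hα : 0 < α n := hmem.1
    have hβ : 0 < β n := hmem.2.1
    have htraj := hsol.isFucikTrajectory
    rw [← Real.sq_sqrt hα.le, ← Real.sq_sqrt hβ.le] at htraj
    obtain ⟨hge, hle⟩ := htraj.integral_sub_sin_sq_le (Real.sqrt_pos.2 hα) (Real.sqrt_pos.2 hβ)
      hslope.le hsol.left_boundary rfl (hcase.imp And.right And.right) hN hlen hsup hPNn
    have hn0 : (0 : ℝ) < n := by
      have : 0 < n := by omega
      exact_mod_cast this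
    have hK : 0 < 1 / (n : ℝ) ^ (1 + ε) := by positivity
    have hN0 : (1 : ℝ) ≤ N := by exact_mod_cast hN
    have hM := hmax n hn
    have hc0 := hc_nonneg n hn
    rcases le_or_gt (β n) (α n) with hαβ | hαβ
    · obtain ⟨hnM, hE⟩ := hge (Real.sqrt_le_sqrt hαβ)
      rw [max_eq_left (Real.sqrt_le_sqrt hαβ)] at hM
      have ht := sq_div_sub_one_le hn0 hnM hc0 hM
      rcases hcase with ⟨he, rfl⟩ | ⟨ho, rfl⟩
      · have hn' : (n : ℝ) = 2 * P := by rw [← hPNn]; push_cast; ring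
        rw [div_self (by positivity), mul_one, ← hn', div_self hn0.ne'] at hE
        exact lt_pi_div_two_mul_of_le_mul hE (by positivity) ht hK (hc_even n hn he) hZ even_constant_le
      · have hn' : (n : ℝ) = 2 * N + 1 := by rw [← hPNn]; push_cast; ring
        push_cast at hE
        exact lt_pi_div_two_mul_of_le_mul hE (by positivity) ht hK (hc_odd_ge n hn ho hαβ) hZ
          (odd_constant_le_of_ge hN0 hn')
    · obtain ⟨hnM, hE⟩ := hle (Real.sqrt_le_sqrt hαβ.le)
      rw [max_eq_right (Real.sqrt_le_sqrt hαβ.le)] at hM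
      have ht := sq_div_sub_one_le hn0 hnM hc0 hM
      rcases hcase with ⟨he, rfl⟩ | ⟨ho, rfl⟩
      · have hn' : (n : ℝ) = 2 * P := by rw [← hPNn]; push_cast; ring
        rw [div_self (by positivity), mul_one, ← hn', div_self hn0.ne'] at hE
        exact lt_pi_div_two_mul_of_le_mul hE (by positivity) ht hK (hc_even n hn he) hZ even_constant_le
      · have hn' : (n : ℝ) = 2 * N + 1 := by rw [← hPNn]; push_cast; ring
        push_cast at hE
        exact lt_pi_div_two_mul_of_le_mul hE (by positivity) ht hK (hc_odd_lt n hn ho hαβ) hZ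
          (odd_constant_le_of_lt hN0 hn')
  obtain ⟨e, he⟩ := exists_hilbertBasis_sine 𝕜
  have hsum := ((hasSum_zeta_sub_one hs).div_const Z).mul_left (Real.pi / 2)
  rw [← hZdef, div_self hZ.ne', mul_one] at hsum
  have hone : ∀ n : ℕ+, (n : ℕ) = 1 → ‖hF.toL2 𝕜 n - sineL2 𝕜 n‖ ^ 2 = 0 := by
    intro n hn
    rw [norm_sq_toL2_sub_sineL2, hn]
    rw [intervalIntegral.integral_congr (g := fun _ => 0), intervalIntegral.integral_zero]
    intro x hx
    rw [Set.uIcc_of_le Real.pi_pos.le] at hx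
    simp [hF.eq_sin x hx]
  have hle : ∀ n : ℕ+, ‖hF.toL2 𝕜 n - sineL2 𝕜 n‖ ^ 2
      ≤ Real.pi / 2 * ((if (n : ℕ) = 1 then 0 else 1 / ((n : ℕ) : ℝ) ^ (1 + ε)) / Z) := by
    intro n
    split_ifs with hn
    · rw [hone n hn]; simp
    · rw [norm_sq_toL2_sub_sineL2]
      exact (hdist n (by have := n.pos; omega)).le
  have hsummable : Summable fun n : ℕ+ => ‖hF.toL2 𝕜 n - sineL2 𝕜 n‖ ^ 2 :=
    hsum.summable.of_nonneg_of_le (fun n => by positivity) hle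
  have hlt : ∑' n : ℕ+, ‖hF.toL2 𝕜 n - sineL2 𝕜 n‖ ^ 2 < Real.pi / 2 := by
    refine hasSum_lt hle (i := (2 : ℕ+)) ?_ hsummable.hasSum hsum
    rw [norm_sq_toL2_sub_sineL2, if_neg (by norm_num)]
    exact hdist _ (by norm_num)
  simp_rw [← he] at hsummable hlt
  refine isRieszBasis_of_tsum_sq_lt e _ (Real.sqrt_pos.2 (by positivity)) hsummable ?_
  rwa [Real.sq_sqrt (by positivity)]
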